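/- Let $m,n\ge 0$, $0\le r\le n$, $I_r=\{1,\dots,r\}$. On $J=J^1(\mathbb R^m\times\mathbb R^n,\mathbb R)$ with canonical coordinates $(t,q,z,s,p)$ let $\Theta=dz-\sum_i p_i\,dq_i-\sum_i s_i\,dt_i$. For $\sigma\subset I_r$ put $$\tilde L^0_\sigma=\{q_\sigma=p_{I_r-\sigma}=q_{r+1}=\dots=q_n=s=z=0,\ q_{I_r-\sigma}\ge 0\},\qquad \mathbb L=\bigcup_{\sigma\subset I_r}\tilde L^0_\sigma .$$ All maps are smooth and considered as germs at $0$. A contact embedding germ $C:(J,0)\to J$ (so $C^*\Theta=\alpha\Theta$ with $\alpha$ non-vanishing) is called a $\mathcal P$-contact embedding germ if $$C(t,q,z,s,p)=(t,\ q_C(t,q,z,p),\ z_C(t,q,z,p),\ h_C(t,q,z,s,p),\ p_C(t,q,z,p))$$ with the $i$-th component of $h_C$ depending only on $t,q,z,s_i,p$ $(i=1,\dots,m)$; it is a $\mathcal P$-contact diffeomorphism germ if moreover $C(0)=0$. Let $C_T$ be the set of $\mathcal P$-contact embedding germs, $C_T^\Theta=\{C\in C_T : C^*\Theta=\Theta\}$,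 and let $C_T^Z$, $C_T^{\Theta,Z}$ be the sets of restrictions to $\{z=0\}$ of the elements of $C_T$, $C_T^\Theta$ respectively. A *reticular Legendrian unfolding* is a map germ $\mathcal L:(\mathbb L,0)\to(J,0)$ that is the restriction to $\mathbb L$ of a $\mathcal P$-contact diffeomorphism germ. Map germs $\mathcal L_1,\mathcal L_2$ on $(\mathbb L,0)$ are *$\mathcal P$-Legendrian equivalent* if $K\circ\mathcal L_1=\mathcal L_2\circ\Psi$ for some contact diffeomorphism germs $K,\Psi$ of $(J,0)$ such that $K$ has the form $(\phi_1(t),\phi_2(t,q,z),\phi_3(t,q,z),\phi_4(t,q,z,s,p),\phi_5(t,q,z,s,p))$, the $t$-component of $\Psi$ depends only on $t$, and $\Psi(\tilde L^0_\sigma)=\tilde L^0_\sigma$ for all $\sigma\subset I_r$. For a class $\mathcal C$ among $C_T$, $C_T^\Theta$, $C_T^Z$, $C_T^{\Theta,Z}$ and an integer $l\ge 0$, say that $\mathcal L$ is $l$-determined with respect to $\mathcal C$ if for every extension $C\in\mathcal C$ of $\mathcal L$ and every $C'\in\mathcal C$ with $j^lC'(0)=j^lC(0)$, the germs $C'|_{\mathbb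 L}$ and $\mathcal L$ are $\mathcal P$-Legendrian equivalent. The class $C_T$ gives the original definition, and $C_T^\Theta$, $C_T^Z$, $C_T^{\Theta,Z}$ give definitions (1), (2), (3). Here "extension" is read in either of two senses: *strict*, $C|_{\mathbb L}=\mathcal L$; or *wide*, $C(\tilde L^0_\sigma)=\mathcal L(\tilde L^0_\sigma)$ as set germs at $0$ for all $\sigma\subset I_r$. **Proposition.** Let $\mathcal L$ be a reticular Legendrian unfolding and $l\ge 0$. In the wide sense: (A) if $\mathcal L$ is $l$-determined in the original definition, then it is $l$-determined in definition (1); (B) if $\mathcal L$ is $l$-determined in definition (1), then it is $l$-determined in definition (3); (C) if $\mathcal L$ is $l$-determined in definition (3), then it is $(l+1)$-determined in definition (2); (D) if $\mathcal L$ is $l$-determined in definition (2), then it is $l$-determined in the original definition. In the strict sense, (A), (B) and (D) hold as well, and (C) holds whenever $\mathcal L$ has at least one strict extension in $C_T^\Theta$. -/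

import Mathlib

open Filter Topology
open scoped ContDiff

namespace RetLeg

/-- The big 1-jet bundle `J¹(ℝᵐ × ℝⁿ, ℝ)` in its canonical coordinates `(t, q, z, s, p)`. -/
abbrev Jet (m n : ℕ) : Type :=
  (Fin m → ℝ) × (Fin n → ℝ) × ℝ × (Fin m → ℝ) × (Fin n → ℝ)

/-- The hyperplane `{Z = 0}` of the 1-jet bundle, in the coordinates `(t, q, s, p)`. -/
abbrev JetZ (m n : ℕ) : Type :=
  (Fin m → ℝ) × (Fin n → ℝ) × (Fin m → ℝ) × (Fin n → ℝ)

variable {m n : ℕ}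

abbrev tc (x : Jet m n) : Fin m → ℝ := x.1
abbrev qc (x : Jet m n) : Fin n → ℝ := x.2.1
abbrev zc (x : Jet m n) : ℝ := x.2.2.1
abbrev sc (x : Jet m n) : Fin m → ℝ := x.2.2.2.1
abbrev pc (x : Jet m n) : Fin n → ℝ := x.2.2.2.2

/-- The inclusion of `{Z = 0}`. -/
def incl (y : JetZ m n) : Jet m n := (y.1, y.2.1, 0, y.2.2.1, y.2.2.2)

/-- The projection forgetting `z`. On `{Z = 0}` it is the inverse of `incl`; it serves to view a
map defined on `{Z = 0}` as a map on the subsets of the 1-jet bundle contained in `{Z = 0}`. -/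
def dropZ (x : Jet m n) : JetZ m n := (tc x, qc x, sc x, pc x)

/-- The canonical 1-form `Θ = dz - ∑ pᵢ dqᵢ - ∑ sᵢ dtᵢ` at `x`, evaluated on the vector `v`. -/
def theta (x v : Jet m n) : ℝ :=
  zc v - ∑ i, pc x i * qc v i - ∑ i, sc x i * tc v i

/-! Map germs at `0` are given by representatives: total functions of which only the values near
`0` matter. Every notion below is invariant under changing a function away from `0`. -/

/-- `f` is a smooth germ at `0`: it is `C^∞` on a neighbourhood of `0`. -/
def SmoothGerm {E F : Type} [NormedAddCommGroup E] [NormedSpace ℝ E]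
    [NormedAddCommGroup F] [NormedSpace ℝ F] (f : E → F) : Prop :=
  ∀ᶠ x in 𝓝 (0 : E), ContDiffAt ℝ ∞ f x

/-- The germ of `f` at `0` depends only on the quantities listed by `c`. -/
def DependsOnly {A B : Type} (f : Jet m n → A) (c : Jet m n → B) : Prop :=
  ∃ g : B → A, ∀ᶠ x in 𝓝 (0 : Jet m n), f x = g (c x)

/-- `f` and `g` have the same `l`-jet at `0`. -/
def SameJet {E F : Type} [NormedAddCommGroup E] [NormedSpace ℝ E]
    [NormedAddCommGroup F] [NormedSpace ℝ F] (l : ℕ) (f g : E → F) : Prop :=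
  ∀ k ≤ l, iteratedFDeriv ℝ k f 0 = iteratedFDeriv ℝ k g 0

/-- Contact embedding germ `(J¹, 0) → J¹`: a smooth germ with injective differential at `0` such
that `C^* Θ = α Θ` for a non-vanishing smooth function germ `α`. The value `C 0` is arbitrary. -/
structure IsContactEmbedding (C : Jet m n → Jet m n) : Prop where
  smooth : SmoothGerm C
  immersive : Function.Injective (fderiv ℝ C 0)
  contact : ∃ α : Jet m n → ℝ, SmoothGerm α ∧ α 0 ≠ 0 ∧
    ∀ᶠ x in 𝓝 (0 : Jet m n), ∀ v, theta (C x) (fderiv ℝ C x v) = α x * theta x v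

/-- Contact diffeomorphism germ `(J¹, 0) → (J¹, 0)`. Source and target have the same dimension, so
by the inverse function theorem this is a contact embedding germ that fixes `0`. -/
structure IsContactDiffeo (C : Jet m n → Jet m n) : Prop extends IsContactEmbedding C where
  map_zero : C 0 = 0

/-- The special form of 𝒫-contact germs:
`C (t,q,z,s,p) = (t, q_C (t,q,z,p), z_C (t,q,z,p), h_C (t,q,z,s,p), p_C (t,q,z,p))`, where
the `i`-th component of `h_C` depends only on `t, q, z, sᵢ, p`. -/
structure HasPForm (C : Jet m n → Jet m n) : Prop where
  t_eq : ∀ᶠ x in 𝓝 (0 : Jet m n), tc (C x) = tc x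
  q_dep : DependsOnly (fun x => qc (C x)) (fun x => (tc x, qc x, zc x, pc x))
  z_dep : DependsOnly (fun x => zc (C x)) (fun x => (tc x, qc x, zc x, pc x))
  s_dep : ∀ i, DependsOnly (fun x => sc (C x) i) (fun x => (tc x, qc x, zc x, sc x i, pc x))
  p_dep : DependsOnly (fun x => pc (C x)) (fun x => (tc x, qc x, zc x, pc x))

/-- 𝒫-contact diffeomorphism germ on `(J¹, 0)`. -/
def IsPContactDiffeo (C : Jet m n → Jet m n) : Prop :=
  IsContactDiffeo C ∧ HasPForm C

/-- `C_T`: the 𝒫-contact embedding germs `(J¹, 0) → J¹`. -/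
def CT (m n : ℕ) : Set (Jet m n → Jet m n) :=
  {C | IsContactEmbedding C ∧ HasPForm C}

/-- `C_T^Θ`: the members of `C_T` with `C^* Θ = Θ`. -/
def CTTheta (m n : ℕ) : Set (Jet m n → Jet m n) :=
  {C | C ∈ CT m n ∧ ∀ᶠ x in 𝓝 (0 : Jet m n), ∀ v, theta (C x) (fderiv ℝ C x v) = theta x v}

/-- `C_T^Z`: the restrictions to `{Z = 0}` of the members of `C_T`. -/
def CTZ (m n : ℕ) : Set (JetZ m n → Jet m n) :=
  {c | ∃ C ∈ CT m n, ∀ᶠ y in 𝓝 (0 : JetZ m n), c y = C (incl y)}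

/-- `C_T^{Θ,Z}`: the restrictions to `{Z = 0}` of the members of `C_T^Θ`. -/
def CTThetaZ (m n : ℕ) : Set (JetZ m n → Jet m n) :=
  {c | ∃ C ∈ CTTheta m n, ∀ᶠ y in 𝓝 (0 : JetZ m n), c y = C (incl y)}

/-- The set `L̃⁰_σ`: `q_σ = 0`, `p_{I_r - σ} = 0`, `q_{r+1} = ⋯ = q_n = 0`, `s = 0`, `z = 0`,
`q_{I_r - σ} ≥ 0`. The indices `1, …, n` are `0, …, n - 1` here, so that `I_r` is `{i | i < r}`;
only the elements of `σ` lying in `I_r` count. -/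
def face (r : ℕ) (σ : Set (Fin n)) : Set (Jet m n) :=
  {x | (∀ i : Fin n, (i : ℕ) < r → i ∈ σ → qc x i = 0) ∧
    (∀ i : Fin n, (i : ℕ) < r → i ∉ σ → pc x i = 0 ∧ 0 ≤ qc x i) ∧
    (∀ i : Fin n, r ≤ (i : ℕ) → qc x i = 0) ∧ sc x = 0 ∧ zc x = 0}

/-- The set `𝕃`, the union of the `L̃⁰_σ`: `q₁p₁ = ⋯ = q_r p_r = q_{r+1} = ⋯ = q_n = 0`, `s = 0`,
`z = 0`, `q₁, …, q_r ≥ 0`. -/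
def corner (m n r : ℕ) : Set (Jet m n) :=
  {x | (∀ i : Fin n, (i : ℕ) < r → qc x i * pc x i = 0 ∧ 0 ≤ qc x i) ∧
    (∀ i : Fin n, r ≤ (i : ℕ) → qc x i = 0) ∧ sc x = 0 ∧ zc x = 0}

/-- Reticular Legendrian unfolding `(𝕃, 0) → (J¹, 0)`: the restriction to `𝕃` of a 𝒫-contact
diffeomorphism germ. Only the values of `L` on `𝕃` near `0` matter. -/
def IsReticularLegendrianUnfolding (r : ℕ) (L : Jet m n → Jet m n) : Prop :=
  ∃ C, IsPContactDiffeo C ∧ ∀ᶠ x in 𝓝[corner m n r] 0, L x = C x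

/-- 𝒫-Legendrian equivalence: a contact diffeomorphism germ of the form
`K (t,q,z,s,p) = (φ₁ (t), φ₂ (t,q,z), φ₃ (t,q,z), φ₄ (t,q,z,s,p), φ₅ (t,q,z,s,p))`. -/
structure IsPLegendrianEquivalence (K : Jet m n → Jet m n) : Prop extends IsContactDiffeo K where
  t_dep : DependsOnly (fun x => tc (K x)) tc
  q_dep : DependsOnly (fun x => qc (K x)) (fun x => (tc x, qc x, zc x))
  z_dep : DependsOnly (fun x => zc (K x)) (fun x => (tc x, qc x, zc x))

/-- Reticular 𝒫-diffeomorphism: a contact diffeomorphism germ whose `t`-component depends only on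
`t` and which preserves every `L̃⁰_σ`. The image under the diffeomorphism germ `Ψ` of the set germ
`A` at `0` is the set germ of which `map Ψ (𝓝[A] 0)` is the filter, so that the last condition
says `Ψ (L̃⁰_σ) = L̃⁰_σ` as set germs at `0`. -/
structure IsReticularPDiffeo (r : ℕ) (Ψ : Jet m n → Jet m n) : Prop extends IsContactDiffeo Ψ where
  t_dep : DependsOnly (fun x => tc (Ψ x)) tc
  preserves : ∀ σ : Set (Fin n), map Ψ (𝓝[face r σ] 0) = 𝓝[face r σ] 0

/-- 𝒫-Legendrian equivalence of map germs on `(𝕃, 0)`: `K ∘ L₁ = L₂ ∘ Ψ`. -/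
def PLegendrianEquivalent (r : ℕ) (L₁ L₂ : Jet m n → Jet m n) : Prop :=
  ∃ K Ψ : Jet m n → Jet m n, IsPLegendrianEquivalence K ∧ IsReticularPDiffeo r Ψ ∧
    ∀ᶠ x in 𝓝[corner m n r] 0, K (L₁ x) = L₂ (Ψ x)

/-- `C` extends `L`: `C|_𝕃 = L`. -/
def Extends (r : ℕ) (L C : Jet m n → Jet m n) : Prop :=
  ∀ᶠ x in 𝓝[corner m n r] 0, C x = L x

/-- `C` defines the unfolded contact regular `r`-cubic configuration of `L`:
`C (L̃⁰_σ) = L (L̃⁰_σ)` for all `σ`, as set germs at `0`. -/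
def Defines (r : ℕ) (L C : Jet m n → Jet m n) : Prop :=
  ∀ σ : Set (Fin n), map C (𝓝[face r σ] 0) = map L (𝓝[face r σ] 0)

/-- `l`-determinacy of `L` relative to a class `𝒞` of germs at `0` of maps `W → J¹`, which are
regarded as maps on `𝕃` through `ρ`, and to a notion `Ext` of extension: for any extension `C ∈ 𝒞`
of `L`, the germs `C'|_𝕃` and `L` are 𝒫-Legendrian equivalent for all `C' ∈ 𝒞` with
`j^l C (0) = j^l C' (0)`. -/
def DeterminedIn {W : Type} [NormedAddCommGroup W] [NormedSpace ℝ W] (r : ℕ)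
    (ρ : Jet m n → W) (𝒞 : Set (W → Jet m n))
    (Ext : (Jet m n → Jet m n) → (Jet m n → Jet m n) → Prop)
    (l : ℕ) (L : Jet m n → Jet m n) : Prop :=
  ∀ C ∈ 𝒞, Ext L (C ∘ ρ) → ∀ C' ∈ 𝒞, SameJet l C C' → PLegendrianEquivalent r (C' ∘ ρ) L

variable (r : ℕ) (Ext : (Jet m n → Jet m n) → (Jet m n → Jet m n) → Prop)
  (l : ℕ) (L : Jet m n → Jet m n)

/-- The original definition of `l`-determinacy. -/
def Determined : Prop := DeterminedIn r id (CT m n) Ext l L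

/-- Definition (1): through germs that preserve `Θ`. -/
def DeterminedTheta : Prop := DeterminedIn r id (CTTheta m n) Ext l L

/-- Definition (2): through germs restricted to `{Z = 0}`. -/
def DeterminedZ : Prop := DeterminedIn r dropZ (CTZ m n) Ext l L

/-- Definition (3): through restrictions to `{Z = 0}` of germs that preserve `Θ`. -/
def DeterminedThetaZ : Prop := DeterminedIn r dropZ (CTThetaZ m n) Ext l L

end RetLeg

/-! Three implications are soft. (A) holds because C_T^Θ ⊂ C_T, and (D) because jets restrict to {z
= 0}, which contains 𝕃. For (B), a germ with C^*Θ = Θ preserves dΘ, hence the Reeb field ∂/∂z, and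
so commutes with translations in z (`eventually_eq_add_of_theta`). Its l-jet is therefore determined
by the l-jet of its restriction to {z = 0} (`SameJet.of_comp_incl`).

(C) needs a passage from C_T to C_T^Θ. The conformal factor of a 𝒫-contact germ C does not depend on
s (`HasPForm.factor_dependsOnly`); let b(t,q,p) be its value on {z = 0}. The fibre rescaling ρ_b :
(t,q,s,p) ↦ (t,q,bs,bp) multiplies Θ by b there, so C∘ρ_b⁻¹, continued by translation in z, is a
germ D in C_T^Θ (`exists_normalForm`). The components bs and bp are, up to sign, the coefficients of
the pull-back of Θ, which involves one derivative of C; this is the loss from l + 1 to l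
(`exists_normalForm_pair`).

Each ρ_b preserves every face. In the wide sense D thus defines the same configuration as C.
Definition (3) applies to D and to the normal form D' of C', and ρ_b' is absorbed into the reticular
diffeomorphism (`PLegendrianEquivalent.of_reparametrization`). In the strict sense D restricts to
L∘ρ_b⁻¹ instead of L. Given E in C_T^Θ extending L, the germ F = D⁻¹∘E lies in C_T^Θ
(`hasPForm_of_comp`) and equals ρ_b on 𝕃. Definition (3) is then applied to E and D'∘F, which have
the same l-jet. -/

namespace RetLeg

/-! ### Calculus of smooth germs and their jets; local inverses -/

section Jets

variable {E F G H : Type} [NormedAddCommGroup E] [NormedSpace ℝ E]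
  [NormedAddCommGroup F] [NormedSpace ℝ F] [NormedAddCommGroup G] [NormedSpace ℝ G]
  [NormedAddCommGroup H] [NormedSpace ℝ H]

theorem SmoothGerm.contDiffAt {f : E → F} (hf : SmoothGerm f) : ContDiffAt ℝ ∞ f 0 :=
  Eventually.self_of_nhds hf

theorem SmoothGerm.continuousAt {f : E → F} (hf : SmoothGerm f) : ContinuousAt f 0 :=
  hf.contDiffAt.continuousAt

theorem SmoothGerm.eventually_differentiableAt {f : E → F} (hf : SmoothGerm f) :
    ∀ᶠ x in 𝓝 (0 : E), DifferentiableAt ℝ f x :=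
  Eventually.mono hf fun _ h => h.differentiableAt (by simp)

theorem ContDiff.smoothGerm {f : E → F} (hf : ContDiff ℝ ∞ f) : SmoothGerm f :=
  Eventually.of_forall fun _ => hf.contDiffAt

theorem SmoothGerm.comp {g : F → G} {f : E → F} (hg : SmoothGerm g) (hf : SmoothGerm f)
    (h0 : f 0 = 0) : SmoothGerm (fun x => g (f x)) := by
  have ht : Tendsto f (𝓝 0) (𝓝 0) := by simpa [ContinuousAt, h0] using hf.continuousAt
  filter_upwards [hf, ht.eventually hg] with x hx hx'
  exact hx'.comp x hx

theorem SmoothGerm.fderiv {f : E → F} (hf : SmoothGerm f) : SmoothGerm (fderiv ℝ f) := by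
  filter_upwards [hf] with x hx
  exact hx.fderiv_right (by simp)

theorem SmoothGerm.clm {f : E → F} (hf : SmoothGerm f) (A : F →L[ℝ] G) :
    SmoothGerm (fun x => A (f x)) := by
  filter_upwards [hf] with x hx
  exact A.contDiff.contDiffAt.comp x hx

theorem SmoothGerm.add {f g : E → F} (hf : SmoothGerm f) (hg : SmoothGerm g) :
    SmoothGerm (fun x => f x + g x) := by
  filter_upwards [hf, hg] with x hx hx'
  exact hx.add hx'

theorem SmoothGerm.bilinear {f : E → F} {g : E → G} (hf : SmoothGerm f) (hg : SmoothGerm g)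
    (B : F →L[ℝ] G →L[ℝ] H) : SmoothGerm (fun x => B (f x) (g x)) := by
  filter_upwards [hf, hg] with x hx hx'
  exact (B.contDiff.contDiffAt.comp x hx).clm_apply hx'

theorem SameJet.refl (l : ℕ) (f : E → F) : SameJet l f f := fun _ _ => rfl

theorem SameJet.symm {l : ℕ} {f g : E → F} (h : SameJet l f g) : SameJet l g f :=
  fun k hk => (h k hk).symm

theorem SameJet.trans {l : ℕ} {f g h : E → F} (h₁ : SameJet l f g) (h₂ : SameJet l g h) :
    SameJet l f h := fun k hk => (h₁ k hk).trans (h₂ k hk)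

theorem SameJet.mono {k l : ℕ} {f g : E → F} (h : SameJet l f g) (hkl : k ≤ l) : SameJet k f g :=
  fun i hi => h i (hi.trans hkl)

theorem SameJet.of_eventuallyEq {f g : E → F} (h : f =ᶠ[𝓝 0] g) (l : ℕ) : SameJet l f g :=
  fun k _ => (Filter.EventuallyEq.iteratedFDeriv ℝ h k).self_of_nhds

theorem sameJet_zero_iff {f g : E → F} : SameJet 0 f g ↔ f 0 = g 0 := by
  constructor
  · intro h
    have := h 0 le_rfl
    rw [iteratedFDeriv_zero_eq_comp, iteratedFDeriv_zero_eq_comp] at this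
    exact (continuousMultilinearCurryFin0 ℝ E F).symm.injective this
  · intro h k hk
    obtain rfl : k = 0 := by omega
    simp [iteratedFDeriv_zero_eq_comp, h]

theorem SameJet.apply_zero {l : ℕ} {f g : E → F} (h : SameJet l f g) : f 0 = g 0 :=
  sameJet_zero_iff.1 (h.mono (Nat.zero_le l))

/-- Trades one order of the jet for one derivative; the jet lemmas below are inductions on l through
this equivalence. -/
theorem sameJet_succ_iff {l : ℕ} {f g : E → F} :
    SameJet (l + 1) f g ↔ f 0 = g 0 ∧ SameJet l (fderiv ℝ f) (fderiv ℝ g) := by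
  have key : ∀ k, iteratedFDeriv ℝ (k + 1) f 0 = iteratedFDeriv ℝ (k + 1) g 0 ↔
      iteratedFDeriv ℝ k (fderiv ℝ f) 0 = iteratedFDeriv ℝ k (fderiv ℝ g) 0 := by
    intro k
    rw [iteratedFDeriv_succ_eq_comp_right, iteratedFDeriv_succ_eq_comp_right]
    exact (continuousMultilinearCurryRightEquiv' ℝ k E F).symm.injective.eq_iff
  constructor
  · exact fun h => ⟨h.apply_zero, fun k hk => (key k).1 (h (k + 1) (by omega))⟩
  · rintro ⟨h0, h⟩ k hk
    cases k with
    | zero => exact sameJet_zero_iff.2 h0 0 le_rfl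
    | succ k => exact (key k).2 (h k (by omega))

theorem SameJet.add {l : ℕ} {E F : Type} [NormedAddCommGroup E] [NormedSpace ℝ E]
    [NormedAddCommGroup F] [NormedSpace ℝ F] {f f' g g' : E → F}
    (hf : SmoothGerm f) (hf' : SmoothGerm f') (hg : SmoothGerm g) (hg' : SmoothGerm g')
    (h₁ : SameJet l f f') (h₂ : SameJet l g g') :
    SameJet l (fun x => f x + g x) (fun x => f' x + g' x) := by
  induction l generalizing F with
  | zero =>
    rw [sameJet_zero_iff] at *
    rw [h₁, h₂]
  | succ l ih =>
    rw [sameJet_succ_iff] at *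
    refine ⟨by rw [h₁.1, h₂.1], ?_⟩
    have e : ∀ {f g : E → F}, SmoothGerm f → SmoothGerm g →
        (fderiv ℝ fun x => f x + g x) =ᶠ[𝓝 0] fun x => fderiv ℝ f x + fderiv ℝ g x := by
      intro f g hf hg
      filter_upwards [hf.eventually_differentiableAt, hg.eventually_differentiableAt] with x hx hx'
      exact fderiv_fun_add hx hx'
    exact ((SameJet.of_eventuallyEq (e hf hg) l).trans
      (ih hf.fderiv hf'.fderiv hg.fderiv hg'.fderiv h₁.2 h₂.2)).trans
      (SameJet.of_eventuallyEq (e hf' hg') l).symm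

/-- By the product rule the derivative is a sum of two bilinear expressions of the same kind, but
with other pairings and other spaces. Hence the induction must let `F`, `G`, `H` vary. -/
theorem SameJet.bilinear {l : ℕ} {E F G H : Type} [NormedAddCommGroup E] [NormedSpace ℝ E]
    [NormedAddCommGroup F] [NormedSpace ℝ F] [NormedAddCommGroup G] [NormedSpace ℝ G]
    [NormedAddCommGroup H] [NormedSpace ℝ H] {f f' : E → F} {g g' : E → G}
    (hf : SmoothGerm f) (hf' : SmoothGerm f') (hg : SmoothGerm g) (hg' : SmoothGerm g')
    (B : F →L[ℝ] G →L[ℝ] H) (h₁ : SameJet l f f') (h₂ : SameJet l g g') :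
    SameJet l (fun x => B (f x) (g x)) (fun x => B (f' x) (g' x)) := by
  induction l generalizing F G H with
  | zero =>
    rw [sameJet_zero_iff] at *
    rw [h₁, h₂]
  | succ l ih =>
    have h₁' := h₁.mono (Nat.le_succ l)
    have h₂' := h₂.mono (Nat.le_succ l)
    rw [sameJet_succ_iff] at *
    refine ⟨by rw [h₁.1, h₂.1], ?_⟩
    have e : ∀ {f : E → F} {g : E → G}, SmoothGerm f → SmoothGerm g →
        (fderiv ℝ fun x => B (f x) (g x)) =ᶠ[𝓝 0] fun x =>
          B.precompR E (f x) (fderiv ℝ g x) + B.precompL E (fderiv ℝ f x) (g x) := by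
      intro f g hf hg
      filter_upwards [hf.eventually_differentiableAt, hg.eventually_differentiableAt] with x hx hx'
      exact B.fderiv_of_bilinear hx hx'
    refine ((SameJet.of_eventuallyEq (e hf hg) l).trans ?_).trans
      (SameJet.of_eventuallyEq (e hf' hg') l).symm
    exact SameJet.add (hf.bilinear hg.fderiv _) (hf'.bilinear hg'.fderiv _)
      (hf.fderiv.bilinear hg _) (hf'.fderiv.bilinear hg' _)
      (ih hf hf' hg.fderiv hg'.fderiv _ h₁' h₂.2) (ih hf.fderiv hf'.fderiv hg hg' _ h₁.2 h₂')

/-- By the chain rule the derivative is bilinear in Dg ∘ f and Df; the induction hypothesis handles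
Dg ∘ f, whose target is a new space. -/
theorem SameJet.comp {l : ℕ} {E F G : Type} [NormedAddCommGroup E] [NormedSpace ℝ E]
    [NormedAddCommGroup F] [NormedSpace ℝ F] [NormedAddCommGroup G] [NormedSpace ℝ G]
    {g g' : F → G} {f f' : E → F}
    (hg : SmoothGerm g) (hg' : SmoothGerm g') (hf : SmoothGerm f) (hf' : SmoothGerm f')
    (h0 : f 0 = 0) (h₁ : SameJet l g g') (h₂ : SameJet l f f') :
    SameJet l (fun x => g (f x)) (fun x => g' (f' x)) := by
  have h0' : f' 0 = 0 := h₂.apply_zero ▸ h0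
  induction l generalizing G with
  | zero =>
    rw [sameJet_zero_iff] at *
    rw [h0, h0', h₁]
  | succ l ih =>
    have h₂' := h₂.mono (Nat.le_succ l)
    rw [sameJet_succ_iff] at *
    refine ⟨by rw [h0, h0', h₁.1], ?_⟩
    have e : ∀ {g : F → G} {f : E → F}, SmoothGerm g → SmoothGerm f → f 0 = 0 →
        (fderiv ℝ fun x => g (f x)) =ᶠ[𝓝 0] fun x =>
          ContinuousLinearMap.compL ℝ E F G (fderiv ℝ g (f x)) (fderiv ℝ f x) := by
      intro g f hg hf h0
      have ht : Tendsto f (𝓝 0) (𝓝 0) := by simpa [ContinuousAt, h0] using hf.continuousAt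
      filter_upwards [hf.eventually_differentiableAt,
        ht.eventually hg.eventually_differentiableAt] with x hx hx'
      exact fderiv_fun_comp x hx' hx
    refine ((SameJet.of_eventuallyEq (e hg hf h0) l).trans ?_).trans
      (SameJet.of_eventuallyEq (e hg' hf' h0') l).symm
    exact SameJet.bilinear (hg.fderiv.comp hf h0) (hg'.fderiv.comp hf' h0') hf.fderiv hf'.fderiv _
      (ih hg.fderiv hg'.fderiv h₁.2 h₂') h₂.2

theorem SameJet.clm {l : ℕ} {f f' : E → F} (hf : SmoothGerm f) (hf' : SmoothGerm f')
    (A : F →L[ℝ] G) (h : SameJet l f f') : SameJet l (fun x => A (f x)) (fun x => A (f' x)) :=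
  SameJet.bilinear (ContDiff.smoothGerm contDiff_const) (ContDiff.smoothGerm contDiff_const) hf hf'
    (ContinuousLinearMap.id ℝ (F →L[ℝ] G)) (SameJet.refl l fun _ => A) h

/-- Germs with the same jet have local inverses with the same jet. -/
theorem SameJet.inverse {l : ℕ} {φ φ' : E → F} {ψ ψ' : F → E}
    (hφ : SmoothGerm φ) (hφ' : SmoothGerm φ') (hψ : SmoothGerm ψ) (hψ' : SmoothGerm ψ')
    (hφ0 : φ 0 = 0) (hψ0' : ψ' 0 = 0)
    (hinv : ∀ᶠ x in 𝓝 (0 : E), ψ (φ x) = x) (hinv' : ∀ᶠ y in 𝓝 (0 : F), φ' (ψ' y) = y)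
    (h : SameJet l φ φ') : SameJet l ψ ψ' := by
  have ht : Tendsto ψ' (𝓝 0) (𝓝 0) := by simpa [ContinuousAt, hψ0'] using hψ'.continuousAt
  have hφ0' : φ' 0 = 0 := h.apply_zero ▸ hφ0
  have h₁ : SameJet l (fun y => φ (ψ' y)) (fun y => φ' (ψ' y)) :=
    SameJet.comp hφ hφ' hψ' hψ' hψ0' h (SameJet.refl _ _)
  -- Both inverses are read off from this pair: ψ ∘ φ ∘ ψ' is ψ', and ψ ∘ φ' ∘ ψ' is ψ.
  have h₂ : SameJet l (fun y => ψ (φ (ψ' y))) (fun y => ψ (φ' (ψ' y))) :=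
    SameJet.comp hψ hψ (hφ.comp hψ' hψ0') (hφ'.comp hψ' hψ0') (by simp [hψ0', hφ0])
      (SameJet.refl _ _) h₁
  have h₃ : (fun y => ψ (φ (ψ' y))) =ᶠ[𝓝 0] ψ' := ht.eventually hinv
  have h₄ : (fun y => ψ (φ' (ψ' y))) =ᶠ[𝓝 0] ψ := by
    filter_upwards [hinv'] with y hy
    rw [hy]
  exact (SameJet.of_eventuallyEq h₄ l).symm.trans (h₂.symm.trans (SameJet.of_eventuallyEq h₃ l))

/-- The inverse function theorem for smooth germs of a finite-dimensional space. -/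
theorem SmoothGerm.exists_localInverse [FiniteDimensional ℝ E] {D : E → E} (hD : SmoothGerm D)
    (hinj : Function.Injective (_root_.fderiv ℝ D 0)) :
    ∃ G : E → E, (∀ᶠ y in 𝓝 (D 0), ContDiffAt ℝ ∞ G y) ∧ G (D 0) = 0 ∧
      (∀ᶠ y in 𝓝 (D 0), D (G y) = y) ∧ ∀ᶠ x in 𝓝 (0 : E), G (D x) = x := by
  have : CompleteSpace E := FiniteDimensional.complete ℝ E
  let e : E ≃L[ℝ] E :=
    (LinearEquiv.ofInjectiveEndo (_root_.fderiv ℝ D 0 : E →ₗ[ℝ] E) hinj).toContinuousLinearEquiv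
  have he : (e : E →L[ℝ] E) = _root_.fderiv ℝ D 0 := by ext x; rfl
  have hs : HasStrictFDerivAt D (e : E →L[ℝ] E) 0 := by
    rw [he]
    exact hD.contDiffAt.hasStrictFDerivAt (by simp)
  let P := hs.toOpenPartialHomeomorph D
  have hP : ∀ x, P x = D x := fun x => by simp [P]
  have h0s : (0 : E) ∈ P.source := hs.mem_toOpenPartialHomeomorph_source
  have h0t : D 0 ∈ P.target := hs.image_mem_toOpenPartialHomeomorph_target
  have hG0 : P.symm (D 0) = 0 := by rw [← hP]; exact P.left_inv h0s
  have hcont : Tendsto P.symm (𝓝 (D 0)) (𝓝 0) := by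
    have := P.symm.continuousAt (x := D 0) h0t
    rwa [ContinuousAt, hG0] at this
  refine ⟨P.symm, ?_, hG0, ?_, ?_⟩
  -- Invertibility of the derivative is an open condition, so the inverse is smooth on a
  -- neighbourhood and not just at `D 0`.
  · have hop : ∀ᶠ x in 𝓝 (0 : E),
        _root_.fderiv ℝ D x ∈ Set.range ((↑) : (E ≃L[ℝ] E) → E →L[ℝ] E) :=
      hD.fderiv.continuousAt.eventually
        (ContinuousLinearEquiv.isOpen.mem_nhds ⟨e, he⟩)
    filter_upwards [P.open_target.mem_nhds h0t, hcont.eventually hop, hcont.eventually hD]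
      with y hy hy' hy''
    obtain ⟨e', he'⟩ := hy'
    refine P.contDiffAt_symm hy (f₀' := e') ?_ ?_
    · rw [he']
      exact (hy''.differentiableAt (by simp)).hasFDerivAt
    · exact hy''
  · filter_upwards [P.open_target.mem_nhds h0t] with y hy
    rw [← hP]
    exact P.right_inv hy
  · filter_upwards [P.open_source.mem_nhds h0s] with x hx
    rw [← hP]
    exact P.left_inv hx

theorem SmoothGerm.eventually_injective [FiniteDimensional ℝ E] {D : E → E} (hD : SmoothGerm D)
    (hinj : Function.Injective (_root_.fderiv ℝ D 0)) :
    ∃ U ∈ 𝓝 (0 : E), Set.InjOn D U := by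
  obtain ⟨G, -, -, -, h⟩ := hD.exists_localInverse hinj
  exact ⟨_, h, fun x hx y hy hxy => by
    have hx' : G (D x) = x := hx
    have hy' : G (D y) = y := hy
    rw [← hx', ← hy', hxy]⟩

/-- Lifting of a germ through an immersion germ of a finite-dimensional space into itself. -/
theorem SmoothGerm.exists_lift [FiniteDimensional ℝ E] {D : E → E} (hD : SmoothGerm D)
    (hinj : Function.Injective (_root_.fderiv ℝ D 0)) {C : F → E} (hC : SmoothGerm C)
    (h0 : C 0 = D 0) :
    ∃ Φ : F → E, SmoothGerm Φ ∧ Φ 0 = 0 ∧ ∀ᶠ x in 𝓝 (0 : F), D (Φ x) = C x := by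
  obtain ⟨G, hG, hG0, hr, -⟩ := hD.exists_localInverse hinj
  have ht : Tendsto C (𝓝 0) (𝓝 (D 0)) := by simpa [ContinuousAt, h0] using hC.continuousAt
  refine ⟨fun x => G (C x), ?_, by simp [h0, hG0], ht.eventually hr⟩
  filter_upwards [hC, ht.eventually hG] with x hx hx'
  exact hx'.comp x hx

end Jets

/-! ### The contact form, its Reeb field, and germs that preserve them -/

section ContactForm

variable (t : Fin m → ℝ) (q : Fin n → ℝ) (z : ℝ) (s : Fin m → ℝ) (p : Fin n → ℝ)

@[simp] theorem tc_mk : tc (m := m) (n := n) (t, q, z, s, p) = t := rfl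
@[simp] theorem qc_mk : qc (m := m) (n := n) (t, q, z, s, p) = q := rfl
@[simp] theorem zc_mk : zc (m := m) (n := n) (t, q, z, s, p) = z := rfl
@[simp] theorem sc_mk : sc (m := m) (n := n) (t, q, z, s, p) = s := rfl
@[simp] theorem pc_mk : pc (m := m) (n := n) (t, q, z, s, p) = p := rfl

theorem jet_ext {x y : Jet m n} (ht : tc x = tc y) (hq : qc x = qc y) (hz : zc x = zc y)
    (hs : sc x = sc y) (hp : pc x = pc y) : x = y :=
  Prod.ext ht (Prod.ext hq (Prod.ext hz (Prod.ext hs hp)))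

/-- The coordinates of the jet space as continuous linear maps. -/
noncomputable def tcL : Jet m n →L[ℝ] (Fin m → ℝ) := ContinuousLinearMap.fst ℝ _ _

noncomputable def qcL : Jet m n →L[ℝ] (Fin n → ℝ) :=
  (ContinuousLinearMap.fst ℝ _ _).comp (ContinuousLinearMap.snd ℝ _ _)

noncomputable def zcL : Jet m n →L[ℝ] ℝ :=
  (ContinuousLinearMap.fst ℝ _ _).comp
    ((ContinuousLinearMap.snd ℝ _ _).comp (ContinuousLinearMap.snd ℝ _ _))

noncomputable def scL : Jet m n →L[ℝ] (Fin m → ℝ) :=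
  (ContinuousLinearMap.fst ℝ _ _).comp ((ContinuousLinearMap.snd ℝ _ _).comp
    ((ContinuousLinearMap.snd ℝ _ _).comp (ContinuousLinearMap.snd ℝ _ _)))

noncomputable def pcL : Jet m n →L[ℝ] (Fin n → ℝ) :=
  (ContinuousLinearMap.snd ℝ _ _).comp ((ContinuousLinearMap.snd ℝ _ _).comp
    ((ContinuousLinearMap.snd ℝ _ _).comp (ContinuousLinearMap.snd ℝ _ _)))

@[simp] theorem tcL_apply (x : Jet m n) : tcL x = tc x := rfl
@[simp] theorem qcL_apply (x : Jet m n) : qcL x = qc x := rfl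
@[simp] theorem zcL_apply (x : Jet m n) : zcL x = zc x := rfl
@[simp] theorem scL_apply (x : Jet m n) : scL x = sc x := rfl
@[simp] theorem pcL_apply (x : Jet m n) : pcL x = pc x := rfl

/-- The inclusion of `{z = 0}` as a continuous linear map. -/
noncomputable def inclL : JetZ m n →L[ℝ] Jet m n :=
  (ContinuousLinearMap.fst ℝ _ _).prod
    (((ContinuousLinearMap.fst ℝ _ _).comp (ContinuousLinearMap.snd ℝ _ _)).prod
      ((0 : JetZ m n →L[ℝ] ℝ).prod
        ((ContinuousLinearMap.snd ℝ _ _).comp (ContinuousLinearMap.snd ℝ _ _))))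

noncomputable def dropL : Jet m n →L[ℝ] JetZ m n := tcL.prod (qcL.prod (scL.prod pcL))

@[simp] theorem inclL_apply (y : JetZ m n) : inclL y = incl y := rfl
@[simp] theorem dropL_apply (x : Jet m n) : dropL x = dropZ x := rfl

/-- The Reeb vector `∂/∂z`. -/
noncomputable def ez : Jet m n := (0, 0, 1, 0, 0)

@[simp] theorem incl_zero : incl (0 : JetZ m n) = 0 := rfl
@[simp] theorem dropZ_zero : dropZ (0 : Jet m n) = 0 := rfl
@[simp] theorem dropZ_incl (y : JetZ m n) : dropZ (incl y) = y := rfl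

theorem incl_dropZ_add (x : Jet m n) : incl (dropZ x) + zc x • ez = x := by
  refine jet_ext ?_ ?_ ?_ ?_ ?_
  · change tc x + zc x • (0 : Fin m → ℝ) = tc x
    simp
  · change qc x + zc x • (0 : Fin n → ℝ) = qc x
    simp
  · change 0 + zc x * 1 = zc x
    simp
  · change sc x + zc x • (0 : Fin m → ℝ) = sc x
    simp
  · change pc x + zc x • (0 : Fin n → ℝ) = pc x
    simp

theorem incl_dropZ {x : Jet m n} (h : zc x = 0) : incl (dropZ x) = x := by
  conv_rhs => rw [← incl_dropZ_add x, h, zero_smul, add_zero]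

/-- The bilinear form `∑ pᵢ(x) qᵢ(v) + ∑ sᵢ(x) tᵢ(v)`. -/
noncomputable def pairing : Jet m n →L[ℝ] Jet m n →L[ℝ] ℝ :=
  (∑ i, (((ContinuousLinearMap.proj i).comp pcL : Jet m n →L[ℝ] ℝ).smulRight
    ((ContinuousLinearMap.proj i).comp qcL : Jet m n →L[ℝ] ℝ))) +
  ∑ i, (((ContinuousLinearMap.proj i).comp scL : Jet m n →L[ℝ] ℝ).smulRight
    ((ContinuousLinearMap.proj i).comp tcL : Jet m n →L[ℝ] ℝ))

theorem pairing_apply (x v : Jet m n) :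
    pairing x v = ∑ i, pc x i * qc v i + ∑ i, sc x i * tc v i := by
  simp [pairing]

theorem theta_eq (x v : Jet m n) : theta x v = zc v - pairing x v := by
  rw [pairing_apply, theta]; ring

/-- `Θ` at `x` as a continuous linear form. -/
noncomputable def thetaL (x : Jet m n) : Jet m n →L[ℝ] ℝ := zcL - pairing x

@[simp] theorem thetaL_apply (x v : Jet m n) : thetaL x v = theta x v := by
  simp [thetaL, theta_eq]

theorem SmoothGerm.thetaL {E : Type} [NormedAddCommGroup E] [NormedSpace ℝ E] {f : E → Jet m n}
    (hf : SmoothGerm f) : SmoothGerm (fun x => RetLeg.thetaL (f x)) := by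
  have hc : SmoothGerm (fun _ : E => (zcL : Jet m n →L[ℝ] ℝ)) := ContDiff.smoothGerm contDiff_const
  simpa [RetLeg.thetaL, sub_eq_add_neg] using hc.add (hf.clm (-pairing (m := m) (n := n)))

theorem SameJet.thetaL {E : Type} [NormedAddCommGroup E] [NormedSpace ℝ E] {l : ℕ}
    {f g : E → Jet m n} (hf : SmoothGerm f) (hg : SmoothGerm g) (h : SameJet l f g) :
    SameJet l (fun x => RetLeg.thetaL (f x)) (fun x => RetLeg.thetaL (g x)) := by
  have hc : SmoothGerm (fun _ : E => (zcL : Jet m n →L[ℝ] ℝ)) := ContDiff.smoothGerm contDiff_const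
  have := SameJet.add hc hc (hf.clm (-pairing (m := m) (n := n)))
    (hg.clm (-pairing (m := m) (n := n))) (SameJet.refl l _)
    (SameJet.clm hf hg (-pairing (m := m) (n := n)) h)
  simpa [RetLeg.thetaL, sub_eq_add_neg] using this

theorem theta_ez (x : Jet m n) : theta x ez = 1 := by simp [theta, ez]

theorem theta_smul_right (x v : Jet m n) (c : ℝ) : theta x (c • v) = c * theta x v := by
  simp only [← thetaL_apply, map_smul, smul_eq_mul]

/-- `dΘ` vanishes only against multiples of the Reeb vector. -/
theorem eq_smul_ez_of_pairing {w : Jet m n} (h : ∀ v, pairing w v = pairing v w) :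
    w = zc w • ez := by
  -- Each coordinate of `w` is isolated by testing against the conjugate basis vector: ∂/∂pᵢ for qᵢ,
  -- ∂/∂sᵢ for tᵢ, and conversely.
  have hq : ∀ i, qc w i = 0 := fun i => by
    simpa [pairing_apply, Pi.single_apply] using (h (0, 0, 0, 0, Pi.single i 1)).symm
  have ht : ∀ i, tc w i = 0 := fun i => by
    simpa [pairing_apply, Pi.single_apply] using (h (0, 0, 0, Pi.single i 1, 0)).symm
  have hp : ∀ i, pc w i = 0 := fun i => by
    simpa [pairing_apply, Pi.single_apply] using h (0, Pi.single i 1, 0, 0, 0)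
  have hs : ∀ i, sc w i = 0 := fun i => by
    simpa [pairing_apply, Pi.single_apply] using h (Pi.single i 1, 0, 0, 0, 0)
  have e : zc w • (ez : Jet m n) = (0, 0, zc w, 0, 0) := by simp [ez]
  rw [e]
  exact jet_ext (funext ht) (funext hq) rfl (funext hs) (funext hp)

/-- A germ that preserves `Θ` preserves `dΘ`. -/
theorem pairing_sub_of_theta {C : Jet m n → Jet m n} {x : Jet m n} (hC : ContDiffAt ℝ ∞ C x)
    (h : ∀ᶠ y in 𝓝 x, ∀ v, theta (C y) (fderiv ℝ C y v) = theta y v) (u v : Jet m n) :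
    pairing (fderiv ℝ C x u) (fderiv ℝ C x v) - pairing (fderiv ℝ C x v) (fderiv ℝ C x u) =
      pairing u v - pairing v u := by
  have hd : DifferentiableAt ℝ C x := hC.differentiableAt (by simp)
  have hd2 : DifferentiableAt ℝ (fderiv ℝ C) x :=
    (hC.fderiv_right (m := ∞) (by simp)).differentiableAt (by simp)
  -- The identity Θ(C)(dC v) = Θ(v) differentiated in the direction `u`. Antisymmetrizing in `u`,
  -- `v` cancels the second derivatives of `C` and leaves dΘ.
  have key : ∀ u v, zc (fderiv ℝ (fderiv ℝ C) x u v) -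
      (pairing (C x) (fderiv ℝ (fderiv ℝ C) x u v) +
        pairing (fderiv ℝ C x u) (fderiv ℝ C x v)) = - pairing u v := by
    intro u v
    have h1 : HasFDerivAt (fun y => fderiv ℝ C y v) ((fderiv ℝ (fderiv ℝ C) x).flip v) x := by
      simpa using hd2.hasFDerivAt.clm_apply (hasFDerivAt_const v x)
    have h2 := (zcL (m := m) (n := n)).hasFDerivAt.comp x h1
    have h3 := (pairing (m := m) (n := n)).hasFDerivAt_of_bilinear hd.hasFDerivAt h1
    have h4 : HasFDerivAt (fun y => zc v - pairing y v) (-(pairing (m := m) (n := n)).flip v) x :=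
      ((pairing (m := m) (n := n)).flip v).hasFDerivAt.const_sub (zc v)
    have h5 : (fun y => zc (fderiv ℝ C y v) - pairing (C y) (fderiv ℝ C y v)) =ᶠ[𝓝 x]
        fun y => zc v - pairing y v := by
      filter_upwards [h] with y hy
      rw [← theta_eq, ← theta_eq, hy]
    have h6 := (HasFDerivAt.sub h2 h3).unique (h4.congr_of_eventuallyEq h5)
    simpa using congrArg (fun A => A u) h6
  have hsymm : fderiv ℝ (fderiv ℝ C) x u v = fderiv ℝ (fderiv ℝ C) x v u :=
    (hC.isSymmSndFDerivAt (by
      rw [minSmoothness_of_isRCLikeNormedField]; exact WithTop.coe_le_coe.2 le_top)) u v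
  have k1 := key u v
  have k2 := key v u
  rw [hsymm] at k1
  linarith

/-- A kernel vector is annihilated by dΘ, hence is a multiple of the Reeb vector; as Θ also vanishes
on it, the multiple is 0. -/
theorem injective_fderiv_of_theta {C : Jet m n → Jet m n} {x : Jet m n}
    (hC : ContDiffAt ℝ ∞ C x)
    (h : ∀ᶠ y in 𝓝 x, ∀ v, theta (C y) (fderiv ℝ C y v) = theta y v) :
    Function.Injective (fderiv ℝ C x) := by
  rw [injective_iff_map_eq_zero]
  intro w hw
  have h1 : w = zc w • ez := eq_smul_ez_of_pairing fun v => by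
    have := pairing_sub_of_theta hC h w v
    rw [hw] at this
    simp at this
    linarith
  have h2 := h.self_of_nhds w
  rw [hw, h1, theta_smul_right, theta_ez, ← thetaL_apply, map_zero] at h2
  rw [h1, show zc w = 0 by linarith, zero_smul]

/-- A germ that preserves `Θ` preserves the Reeb vector field. -/
theorem fderiv_ez_of_theta {C : Jet m n → Jet m n} {x : Jet m n} (hC : ContDiffAt ℝ ∞ C x)
    (h : ∀ᶠ y in 𝓝 x, ∀ v, theta (C y) (fderiv ℝ C y v) = theta y v) :
    fderiv ℝ C x ez = ez := by
  -- Surjectivity lets dΘ be tested on all vectors at the image point, which shows that the image of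
  -- the Reeb vector is again a multiple of it.
  have hsurj : Function.Surjective (fderiv ℝ C x) :=
    LinearMap.injective_iff_surjective (f := (fderiv ℝ C x : Jet m n →ₗ[ℝ] Jet m n)) |>.1
      (injective_fderiv_of_theta hC h)
  set w := fderiv ℝ C x ez with hw
  have h1 : w = zc w • ez := eq_smul_ez_of_pairing fun v => by
    obtain ⟨v', rfl⟩ := hsurj v
    have := pairing_sub_of_theta hC h ez v'
    rw [← hw] at this
    have e : pairing (ez : Jet m n) v' = 0 ∧ pairing v' (ez : Jet m n) = 0 := by
      simp [pairing_apply, ez]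
    rw [e.1, e.2] at this
    linarith
  have h2 := h.self_of_nhds ez
  rw [← hw, h1, theta_smul_right, theta_ez, theta_ez] at h2
  rw [h1, show zc w = 1 by linarith, one_smul]

/-- A germ that preserves `Θ` commutes with translations in `z`. -/
theorem eventually_eq_add_of_theta {C : Jet m n → Jet m n} (hC : SmoothGerm C)
    (h : ∀ᶠ y in 𝓝 (0 : Jet m n), ∀ v, theta (C y) (fderiv ℝ C y v) = theta y v) :
    ∀ᶠ x in 𝓝 (0 : Jet m n), C x = C (incl (dropZ x)) + zc x • ez := by
  have hev : ∀ᶠ x in 𝓝 (0 : Jet m n), DifferentiableAt ℝ C x ∧ fderiv ℝ C x ez = ez := by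
    filter_upwards [hC, h.eventually_nhds] with x hx hx'
    exact ⟨hx.differentiableAt (by simp), fderiv_ez_of_theta hx hx'⟩
  obtain ⟨ε, hε, hball⟩ := Metric.eventually_nhds_iff_ball.1 hev
  filter_upwards [Metric.ball_mem_nhds (0 : Jet m n) hε] with x hx
  -- The defect of translation equivariance along the vertical segment from {z = 0} to `x`; its
  -- derivative is a multiple of dC(∂/∂z) - ∂/∂z = 0.
  let γ : ℝ → Jet m n := fun τ => C (incl (dropZ x) + (τ * zc x) • ez) - (τ * zc x) • ez
  -- The norm is a maximum over coordinates, and only |z| shrinks along the segment.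
  have hmem : ∀ τ ∈ Set.Icc (0 : ℝ) 1,
      incl (dropZ x) + (τ * zc x) • ez ∈ Metric.ball (0 : Jet m n) ε := by
    intro τ hτ
    rw [mem_ball_zero_iff] at hx ⊢
    refine lt_of_le_of_lt ?_ hx
    obtain ⟨t, q, z, s, p⟩ := x
    simp only [incl, dropZ, ez, Prod.norm_def, Prod.smul_mk, smul_zero, Prod.mk_add_mk, add_zero,
      zero_add, smul_eq_mul, mul_one, norm_mul]
    have : ‖τ‖ * ‖z‖ ≤ ‖z‖ := by
      refine mul_le_of_le_one_left (norm_nonneg _) ?_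
      rw [Real.norm_eq_abs, abs_of_nonneg hτ.1]
      exact hτ.2
    gcongr
  have hder : ∀ τ ∈ Set.Icc (0 : ℝ) 1, HasDerivAt γ 0 τ := by
    intro τ hτ
    obtain ⟨h1, h2⟩ := hball _ (hmem τ hτ)
    have h3 : HasDerivAt (fun τ : ℝ => (τ * zc x) • (ez : Jet m n)) (zc x • ez) τ := by
      simpa using ((hasDerivAt_id τ).mul_const (zc x)).smul_const (ez : Jet m n)
    have h4 := h1.hasFDerivAt.comp_hasDerivAt τ (h3.const_add (incl (dropZ x)))
    have h5 := h4.sub h3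
    rw [map_smul, h2, sub_self] at h5
    exact h5
  have hconst := constant_of_has_deriv_right_zero
    (fun τ hτ => (hder τ hτ).continuousAt.continuousWithinAt)
    (fun τ hτ => (hder τ ⟨hτ.1, hτ.2.le⟩).hasDerivWithinAt) 1 ⟨zero_le_one, le_rfl⟩
  simp only [γ, one_mul, zero_mul, zero_smul, add_zero, sub_zero, incl_dropZ_add] at hconst
  rw [← hconst, sub_add_cancel]

end ContactForm

/-! ### Which coordinates the components and the conformal factor depend on -/

section Dependence

/-- All coordinates but `s`. -/
abbrev base (x : Jet m n) : (Fin m → ℝ) × (Fin n → ℝ) × ℝ × (Fin n → ℝ) :=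
  (tc x, qc x, zc x, pc x)

/-- The coordinates `(t, q, z, sᵢ, p)`. -/
abbrev baseS (i : Fin m) (x : Jet m n) : (Fin m → ℝ) × (Fin n → ℝ) × ℝ × ℝ × (Fin n → ℝ) :=
  (tc x, qc x, zc x, sc x i, pc x)

/-- The witness g is replaced by constancy on the fibres of `c` over pairs of nearby points, a form
that passes to derivatives and compositions. Nonemptiness supplies the values of g off the image of
`c`. -/
theorem dependsOnly_iff {A B : Type} [Nonempty A] {f : Jet m n → A} {c : Jet m n → B} :
    DependsOnly f c ↔ ∀ᶠ p in 𝓝 (0 : Jet m n) ×ˢ 𝓝 (0 : Jet m n), c p.1 = c p.2 → f p.1 = f p.2 := by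
  classical
  constructor
  · rintro ⟨g, hg⟩
    filter_upwards [hg.prod_mk hg] with p hp h
    rw [hp.1, hp.2, h]
  · intro h
    obtain ⟨U, hU, hUf⟩ := eventually_prod_self_iff (r := fun x y => c x = c y → f x = f y).1 h
    refine ⟨fun b => if h : ∃ x ∈ U, c x = b then f h.choose else Classical.arbitrary A, ?_⟩
    filter_upwards [hU] with x hx
    have hex : ∃ y ∈ U, c y = c x := ⟨x, hx, rfl⟩
    rw [dif_pos hex]
    exact hUf x hx _ hex.choose_spec.1 hex.choose_spec.2.symm

theorem DependsOnly.eventually {A B : Type} {f : Jet m n → A} {c : Jet m n → B}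
    (h : DependsOnly f c) :
    ∀ᶠ p in 𝓝 (0 : Jet m n) ×ˢ 𝓝 (0 : Jet m n), c p.1 = c p.2 → f p.1 = f p.2 := by
  obtain ⟨g, hg⟩ := h
  filter_upwards [hg.prod_mk hg] with p hp h
  rw [hp.1, hp.2, h]

/-- Directional derivatives of a function depend on the same quantities as the function. -/
theorem DependsOnly.fderiv_apply {A B : Type} [NormedAddCommGroup A] [NormedSpace ℝ A]
    {f : Jet m n → A} {c : Jet m n → B} (h : DependsOnly f c)
    (hf : ∀ᶠ x in 𝓝 (0 : Jet m n), DifferentiableAt ℝ f x) (e : Jet m n)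
    (hc : ∀ x y (τ : ℝ), c x = c y → c (x + τ • e) = c (y + τ • e)) :
    DependsOnly (fun x => fderiv ℝ f x e) c := by
  rw [dependsOnly_iff]
  have h' := h.eventually
  rw [← nhds_prod_eq] at h'
  have h'' := h'.eventually_nhds
  rw [nhds_prod_eq] at h''
  filter_upwards [h'', hf.prod_mk hf] with p hp hd hcp
  -- Only values along two parallel lines enter, and there `hc` keeps the listed quantities equal.
  rw [← hd.1.lineDeriv_eq_fderiv, ← hd.2.lineDeriv_eq_fderiv]
  apply Filter.EventuallyEq.deriv_eq
  have ht : Tendsto (fun τ : ℝ => (p.1 + τ • e, p.2 + τ • e)) (𝓝 0) (𝓝 p) := by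
    have : Continuous fun τ : ℝ => (p.1 + τ • e, p.2 + τ • e) := by fun_prop
    simpa using this.tendsto 0
  filter_upwards [ht.eventually hp] with τ hτ
  exact hτ (hc _ _ _ hcp)

theorem base_add_smul (e x y : Jet m n) (τ : ℝ) (h : base x = base y) :
    base (x + τ • e) = base (y + τ • e) := by
  simp only [base, Prod.mk.injEq] at h ⊢
  obtain ⟨h1, h2, h3, h4⟩ := h
  refine ⟨?_, ?_, ?_, ?_⟩
  · change tc x + τ • tc e = tc y + τ • tc e
    rw [h1]
  · change qc x + τ • qc e = qc y + τ • qc e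
    rw [h2]
  · change zc x + τ • zc e = zc y + τ • zc e
    rw [h3]
  · change pc x + τ • pc e = pc y + τ • pc e
    rw [h4]

variable {C : Jet m n → Jet m n}

theorem HasPForm.tc_fderiv (hP : HasPForm C) (hC : SmoothGerm C) :
    ∀ᶠ x in 𝓝 (0 : Jet m n), ∀ e, tc (fderiv ℝ C x e) = tc e := by
  filter_upwards [hP.t_eq.eventually_nhds, hC.eventually_differentiableAt] with x hx hd e
  have h1 := (tcL (m := m) (n := n)).hasFDerivAt.comp x hd.hasFDerivAt
  have h2 := ((tcL (m := m) (n := n)).hasFDerivAt (x := x)).congr_of_eventuallyEq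
    (show (fun x => tcL (C x)) =ᶠ[𝓝 x] fun x => tcL x from hx)
  exact congrArg (fun A => A e) (h1.unique h2)

/-- Since the t-component of `C` is t, the added sum cancels the term of Θ(C)(dC e) that contains
h_C. What remains, dz - ∑ pᵢ dqᵢ along dC e, is built from components independent of s and their
derivatives. -/
theorem HasPForm.theta_add_dependsOnly (hP : HasPForm C) (hC : SmoothGerm C) (e : Jet m n) :
    DependsOnly (fun x => theta (C x) (fderiv ℝ C x e) + ∑ i, sc (C x) i * tc e i) base := by
  have hd := hC.eventually_differentiableAt
  have hq := (hP.q_dep.fderiv_apply (hd.mono fun x hx => (qcL.differentiableAt.comp x hx :)) e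
    (base_add_smul e)).eventually
  have hz := (hP.z_dep.fderiv_apply (hd.mono fun x hx => (zcL.differentiableAt.comp x hx :)) e
    (base_add_smul e)).eventually
  rw [dependsOnly_iff]
  have ht := hP.tc_fderiv hC
  filter_upwards [hq, hz, hP.p_dep.eventually, hd.prod_mk hd, ht.prod_mk ht]
    with p hq hz hp hd ht hb
  have eq : ∀ x, DifferentiableAt ℝ C x →
      fderiv ℝ (fun x => qc (C x)) x e = qc (fderiv ℝ C x e) := fun x hx =>
    congrArg (fun A => A e) ((qcL (m := m) (n := n)).hasFDerivAt.comp x hx.hasFDerivAt).fderiv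
  have ez : ∀ x, DifferentiableAt ℝ C x →
      fderiv ℝ (fun x => zc (C x)) x e = zc (fderiv ℝ C x e) := fun x hx =>
    congrArg (fun A => A e) ((zcL (m := m) (n := n)).hasFDerivAt.comp x hx.hasFDerivAt).fderiv
  have hq' := hq hb
  have hz' := hz hb
  have hp' : pc (C p.1) = pc (C p.2) := hp hb
  simp only [eq _ hd.1, eq _ hd.2] at hq'
  simp only [ez _ hd.1, ez _ hd.2] at hz'
  simp only [theta]
  rw [hq', hz', hp', ht.1, ht.2]
  ring

/-- The conformal factor of a `𝒫`-contact germ does not depend on `s`. -/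
theorem HasPForm.factor_dependsOnly (hP : HasPForm C) (hC : SmoothGerm C) {α : Jet m n → ℝ}
    (hα : ∀ᶠ x in 𝓝 (0 : Jet m n), ∀ v, theta (C x) (fderiv ℝ C x v) = α x * theta x v) :
    DependsOnly α base := by
  obtain ⟨g, hg⟩ := hP.theta_add_dependsOnly hC ez
  -- The direction ∂/∂z has no t-part and Θ(∂/∂z) = 1, so the expression above is the factor itself.
  refine ⟨g, ?_⟩
  filter_upwards [hg, hα] with x hx hx'
  rw [← hx, hx', theta_ez]
  simp [ez]

/-- The `s`-components of a germ in `C_T^Θ` are `sᵢ` up to functions of the other coordinates. -/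
theorem sc_sub_dependsOnly (hC : C ∈ CTTheta m n) (i : Fin m) :
    DependsOnly (fun x => sc (C x) i - sc x i) base := by
  -- In the direction ∂/∂tᵢ the sum is the i-th s-component of `C`, while Θ(∂/∂tᵢ) = -sᵢ.
  obtain ⟨g, hg⟩ := hC.1.2.theta_add_dependsOnly hC.1.1.smooth (Pi.single i 1, 0, 0, 0, 0)
  refine ⟨g, ?_⟩
  filter_upwards [hg, hC.2] with x hx hx'
  rw [← hx, hx']
  simp [theta, Pi.single_apply]
  ring

end Dependence

/-! ### Fibre rescalings of {z = 0} -/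

section Rescaling

/-- The inverse of the fibrewise rescaling `(a, p) ↦ (a, b (a, p) p)` is a rescaling. -/
theorem exists_inverse_rescaling {A V : Type} [NormedAddCommGroup A] [NormedSpace ℝ A]
    [FiniteDimensional ℝ A] [NormedAddCommGroup V] [NormedSpace ℝ V] [FiniteDimensional ℝ V]
    {b : A × V → ℝ} (hb : SmoothGerm b) (hb0 : b 0 ≠ 0) :
    ∃ κ : A × V → ℝ, SmoothGerm κ ∧ κ 0 ≠ 0 ∧
      (∀ᶠ y in 𝓝 (0 : A × V), κ y * b (y.1, κ y • y.2) = 1) ∧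
      ∀ᶠ y in 𝓝 (0 : A × V), b y * κ (y.1, b y • y.2) = 1 := by
  let g : A × V → A × V := fun y => (y.1, b y • y.2)
  have hg : SmoothGerm g := by
    filter_upwards [hb] with y hy
    exact contDiffAt_fst.prodMk (hy.smul contDiffAt_snd)
  have hg0 : g 0 = 0 := by simp [g]
  have hinj : Function.Injective (fderiv ℝ g 0) := by
    have h1 : HasFDerivAt b (fderiv ℝ b 0) 0 :=
      (hb.contDiffAt.differentiableAt (by simp)).hasFDerivAt
    have h2 : HasFDerivAt g _ 0 :=
      (hasFDerivAt_fst (𝕜 := ℝ) (p := (0 : A × V))).prodMk (h1.smul hasFDerivAt_snd)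
    rw [h2.fderiv, injective_iff_map_eq_zero]
    rintro ⟨a, v⟩ hv
    simpa [hb0] using hv
  obtain ⟨γ, hγ, hγ0, hr, hl⟩ := hg.exists_localInverse hinj
  rw [hg0] at hγ hγ0 hr
  have hγc : Tendsto γ (𝓝 0) (𝓝 0) := by
    simpa [ContinuousAt, hγ0] using (SmoothGerm.continuousAt hγ)
  have hne : ∀ᶠ y in 𝓝 (0 : A × V), b y ≠ 0 := hb.continuousAt.eventually_ne hb0
  -- The inverse γ of g keeps the first coordinate and divides the second by b at the preimage,
  -- which dictates this κ.
  refine ⟨fun y => (b (γ y))⁻¹, ?_, by simpa [hγ0] using hb0, ?_, ?_⟩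
  · filter_upwards [hb.comp hγ hγ0, hγc.eventually hne] with y hy hy'
    exact hy.inv hy'
  · filter_upwards [hr, hγc.eventually hne] with y hy hy'
    change ((γ y).1, b (γ y) • (γ y).2) = y at hy
    have h1 : (γ y).1 = y.1 := (Prod.ext_iff.1 hy).1
    have h2 : b (γ y) • (γ y).2 = y.2 := (Prod.ext_iff.1 hy).2
    have h3 : (y.1, (b (γ y))⁻¹ • y.2) = γ y := by
      rw [← h2, ← h1, smul_smul, inv_mul_cancel₀ hy', one_smul]
    rw [h3, inv_mul_cancel₀ hy']
  · filter_upwards [hl, hne] with y hy hy'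
    have h3 : γ (y.1, b y • y.2) = y := hy
    rw [h3, mul_inv_cancel₀ hy']

/-- The coordinates `(t, q, p)`, grouped for rescaling the fibres. -/
noncomputable def fibreBase : JetZ m n →L[ℝ] ((Fin m → ℝ) × (Fin n → ℝ)) × (Fin n → ℝ) :=
  (((ContinuousLinearMap.fst ℝ _ _)).prod
    ((ContinuousLinearMap.fst ℝ _ _).comp (ContinuousLinearMap.snd ℝ _ _))).prod
    ((ContinuousLinearMap.snd ℝ _ _).comp
      ((ContinuousLinearMap.snd ℝ _ _).comp (ContinuousLinearMap.snd ℝ _ _)))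

theorem fibreBase_apply (y : JetZ m n) : fibreBase y = ((y.1, y.2.1), y.2.2.2) := rfl

/-- The germ `(t, q, s, p) ↦ (t, q, b s, b p)` with `b = b (t, q, p)`. -/
noncomputable def rescale (b : ((Fin m → ℝ) × (Fin n → ℝ)) × (Fin n → ℝ) → ℝ)
    (y : JetZ m n) : JetZ m n :=
  (y.1, y.2.1, b (fibreBase y) • y.2.2.1, b (fibreBase y) • y.2.2.2)

variable {b κ : ((Fin m → ℝ) × (Fin n → ℝ)) × (Fin n → ℝ) → ℝ}

theorem rescale_zero : rescale b (0 : JetZ m n) = 0 := by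
  simp [rescale]

theorem SmoothGerm.rescale (hb : SmoothGerm b) : SmoothGerm (RetLeg.rescale b) := by
  have h : SmoothGerm fun y => b (fibreBase (m := m) (n := n) y) :=
    hb.comp (ContDiff.smoothGerm fibreBase.contDiff) (map_zero _)
  filter_upwards [h] with y hy
  exact contDiffAt_fst.prodMk (contDiffAt_snd.fst.prodMk
    ((hy.smul contDiffAt_snd.snd.fst).prodMk (hy.smul contDiffAt_snd.snd.snd)))

theorem rescale_rescale
    (h : ∀ᶠ w in 𝓝 (0 : ((Fin m → ℝ) × (Fin n → ℝ)) × (Fin n → ℝ)),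
      κ w * b (w.1, κ w • w.2) = 1) :
    ∀ᶠ y in 𝓝 (0 : JetZ m n), rescale b (rescale κ y) = y := by
  have ht : Tendsto (fibreBase (m := m) (n := n)) (𝓝 0) (𝓝 0) := by
    simpa using fibreBase.continuous.tendsto (0 : JetZ m n)
  filter_upwards [ht.eventually h] with y hy
  simp only [fibreBase_apply] at hy
  simp only [rescale, fibreBase_apply, smul_smul]
  rw [mul_comm] at hy
  rw [hy, one_smul, one_smul]

theorem fderiv_rescale_fst (hb : SmoothGerm b) : ∀ᶠ y in 𝓝 (0 : JetZ m n), ∀ v,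
    (fderiv ℝ (rescale b) y v).1 = v.1 ∧ (fderiv ℝ (rescale b) y v).2.1 = v.2.1 := by
  filter_upwards [hb.rescale.eventually_differentiableAt] with y hy v
  constructor
  · exact congrArg (fun A => A v) ((hy.hasFDerivAt.fst).unique
      (hasFDerivAt_fst (𝕜 := ℝ) (p := y)))
  · exact congrArg (fun A => A v) ((hy.hasFDerivAt.snd.fst).unique
      (hasFDerivAt_snd (𝕜 := ℝ) (p := y)).fst)

/-- On `{z = 0}` a rescaling multiplies `Θ` by its factor. -/
theorem theta_rescale {w v : JetZ m n} {y : JetZ m n} (h1 : w.1 = v.1) (h2 : w.2.1 = v.2.1) :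
    theta (incl (rescale b y)) (incl w) = b (fibreBase y) * theta (incl y) (incl v) := by
  simp only [theta, incl, rescale, zc_mk, pc_mk, qc_mk, sc_mk, tc_mk, h1, h2, Pi.smul_apply,
    smul_eq_mul, mul_sub, Finset.mul_sum, mul_assoc, mul_zero]

end Rescaling

/-! ### The faces of 𝕃 and the reparametrizations that preserve them -/

section Faces

theorem face_zc {r : ℕ} {σ : Set (Fin n)} {x : Jet m n} (h : x ∈ face r σ) : zc x = 0 :=
  h.2.2.2.2

theorem zero_mem_face (r : ℕ) (σ : Set (Fin n)) : (0 : Jet m n) ∈ face r σ :=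
  ⟨fun _ _ _ => rfl, fun _ _ _ => ⟨rfl, le_rfl⟩, fun _ _ => rfl, rfl, rfl⟩

theorem corner_eq_iUnion (r : ℕ) : corner m n r = ⋃ σ : Set (Fin n), face r σ := by
  ext x
  simp only [corner, face, Set.mem_iUnion, Set.mem_ofPred_eq]
  constructor
  · rintro ⟨h1, h2, h3, h4⟩
    -- Off the vanishing set of q, the equation qᵢpᵢ = 0 forces pᵢ = 0.
    refine ⟨{i | qc x i = 0}, fun i _ hi => hi, fun i hi hi' => ?_, h2, h3, h4⟩
    exact ⟨(mul_eq_zero.1 (h1 i hi).1).resolve_left hi', (h1 i hi).2⟩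
  · rintro ⟨σ, h1, h2, h3, h4, h5⟩
    refine ⟨fun i hi => ?_, h3, h4, h5⟩
    by_cases hσ : i ∈ σ
    · rw [h1 i hi hσ]; simp
    · rw [(h2 i hi hσ).1]; simp [(h2 i hi hσ).2]

theorem eventually_corner_iff {r : ℕ} {P : Jet m n → Prop} :
    (∀ᶠ x in 𝓝[corner m n r] 0, P x) ↔ ∀ σ, ∀ᶠ x in 𝓝[face r σ] 0, P x := by
  rw [corner_eq_iUnion, nhdsWithin_iUnion, eventually_iSup]

theorem zero_mem_corner (r : ℕ) : (0 : Jet m n) ∈ corner m n r := by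
  rw [corner_eq_iUnion]
  exact Set.mem_iUnion.2 ⟨∅, zero_mem_face r ∅⟩

theorem eventually_corner_zc (r : ℕ) : ∀ᶠ x in 𝓝[corner m n r] 0, zc x = 0 :=
  eventually_nhdsWithin_of_forall fun _ h => h.2.2.2

/-- The germ at `0` of `χ`, on `{z = 0}`, preserves every face. -/
def PreservesFaces (r : ℕ) (χ : JetZ m n → JetZ m n) : Prop :=
  ∀ σ : Set (Fin n), map (fun x => incl (χ (dropZ x))) (𝓝[face r σ] 0) = 𝓝[face r σ] 0

theorem PreservesFaces.comp {r : ℕ} {χ χ' : JetZ m n → JetZ m n} (h : PreservesFaces r χ)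
    (h' : PreservesFaces r χ') : PreservesFaces r (fun y => χ (χ' y)) := by
  intro σ
  conv_rhs => rw [← h σ, ← h' σ, map_map]
  rfl

theorem PreservesFaces.tendsto {r : ℕ} {χ : JetZ m n → JetZ m n} (h : PreservesFaces r χ)
    (σ : Set (Fin n)) :
    Tendsto (fun x => incl (χ (dropZ x))) (𝓝[face r σ] 0) (𝓝[face r σ] 0) := (h σ).le

theorem tendsto_dropZ (r : ℕ) (σ : Set (Fin n)) :
    Tendsto (dropZ : Jet m n → JetZ m n) (𝓝[face r σ] 0) (𝓝 0) := by
  have : Tendsto (dropZ : Jet m n → JetZ m n) (𝓝 0) (𝓝 0) :=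
    (dropL (m := m) (n := n)).continuous.tendsto 0
  exact this.mono_left nhdsWithin_le_nhds

theorem tendsto_incl : Tendsto (incl : JetZ m n → Jet m n) (𝓝 0) (𝓝 0) :=
  (inclL (m := m) (n := n)).continuous.tendsto 0

theorem incl_rescale_mem_face {r : ℕ} {σ : Set (Fin n)} {x : Jet m n} (h : x ∈ face r σ)
    (b : ((Fin m → ℝ) × (Fin n → ℝ)) × (Fin n → ℝ) → ℝ) :
    incl (rescale b (dropZ x)) ∈ face r σ := by
  obtain ⟨h1, h2, h3, h4, h5⟩ := h
  refine ⟨h1, fun i hi hi' => ⟨?_, (h2 i hi hi').2⟩, h3, ?_, rfl⟩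
  · change b _ * pc x i = 0
    rw [(h2 i hi hi').1, mul_zero]
  · change b _ • sc x = 0
    rw [h4, smul_zero]

/-- A rescaling fixes q and keeps zero coordinates of s and p zero, so it maps each face into
itself; the same holds for its inverse, which gives equality of germs. -/
theorem preservesFaces_rescale {b κ : ((Fin m → ℝ) × (Fin n → ℝ)) × (Fin n → ℝ) → ℝ}
    (hb : SmoothGerm b) (hκ : SmoothGerm κ)
    (h : ∀ᶠ y in 𝓝 (0 : JetZ m n), rescale b (rescale κ y) = y) (r : ℕ) :
    PreservesFaces r (rescale (m := m) (n := n) b) := by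
  intro σ
  have ht : ∀ {b : ((Fin m → ℝ) × (Fin n → ℝ)) × (Fin n → ℝ) → ℝ}, SmoothGerm b →
      Tendsto (fun x => incl (rescale b (dropZ x))) (𝓝[face r σ] 0) (𝓝[face r σ] 0) := by
    intro b hb
    refine tendsto_nhdsWithin_iff.2 ⟨?_, eventually_nhdsWithin_of_forall fun x hx =>
      incl_rescale_mem_face hx b⟩
    have h1 : Tendsto (rescale b) (𝓝 (0 : JetZ m n)) (𝓝 0) := by
      simpa [ContinuousAt, rescale_zero] using hb.rescale.continuousAt
    exact tendsto_incl.comp (h1.comp (tendsto_dropZ r σ))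
  refine le_antisymm (ht hb) ?_
  have hid : (fun x => incl (rescale b (dropZ (incl (rescale κ (dropZ x))))))
      =ᶠ[𝓝[face r σ] 0] id := by
    filter_upwards [(tendsto_dropZ r σ).eventually h, self_mem_nhdsWithin] with x hx hx'
    rw [dropZ_incl, hx, incl_dropZ (face_zc hx')]
    rfl
  calc 𝓝[face r σ] 0 = map (fun x => incl (rescale b (dropZ x)))
        (map (fun x => incl (rescale κ (dropZ x))) (𝓝[face r σ] 0)) := by
          rw [map_map]
          exact (map_id.symm.trans (map_congr hid.symm))
    _ ≤ _ := map_mono (ht hκ)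

end Faces

/-! ### Normalizing a 𝒫-contact germ to one that preserves Θ -/

section NormalForm

theorem DependsOnly.comp_tendsto {A B B' : Type} {f : Jet m n → A} {c : Jet m n → B}
    {c' : Jet m n → B'} [Nonempty A] (h : DependsOnly f c) {F : Jet m n → Jet m n}
    (hF : Tendsto F (𝓝 0) (𝓝 0))
    (hc : ∀ᶠ p in 𝓝 (0 : Jet m n) ×ˢ 𝓝 (0 : Jet m n),
      c' p.1 = c' p.2 → c (F p.1) = c (F p.2)) :
    DependsOnly (fun x => f (F x)) c' := by
  rw [dependsOnly_iff]
  filter_upwards [hc, (hF.prodMap hF).eventually h.eventually] with p hp hp' h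
  exact hp' (hp h)

theorem DependsOnly.congr {A B : Type} {f f' : Jet m n → A} {c : Jet m n → B}
    (h : DependsOnly f c) (hf : f =ᶠ[𝓝 0] f') : DependsOnly f' c := by
  obtain ⟨g, hg⟩ := h
  refine ⟨g, ?_⟩
  filter_upwards [hg, hf] with x hx hx'
  rw [← hx', hx]

/-- The inclusion of the coordinates `(t, q, p)`. -/
noncomputable def fibreIncl :
    (((Fin m → ℝ) × (Fin n → ℝ)) × (Fin n → ℝ)) →L[ℝ] Jet m n :=
  ((ContinuousLinearMap.fst ℝ _ _).comp (ContinuousLinearMap.fst ℝ _ _)).prod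
    (((ContinuousLinearMap.snd ℝ _ _).comp (ContinuousLinearMap.fst ℝ _ _)).prod
      (ContinuousLinearMap.prod 0 (ContinuousLinearMap.prod 0 (ContinuousLinearMap.snd ℝ _ _))))

theorem exists_factor_on_zero {C : Jet m n → Jet m n} (hC : C ∈ CT m n) :
    ∃ b : ((Fin m → ℝ) × (Fin n → ℝ)) × (Fin n → ℝ) → ℝ, SmoothGerm b ∧ b 0 ≠ 0 ∧
      ∀ᶠ y in 𝓝 (0 : JetZ m n), ∀ v, theta (C (incl y)) (fderiv ℝ C (incl y) (incl v)) =
        b (fibreBase y) * theta (incl y) (incl v) := by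
  obtain ⟨α, hα, hα0, h⟩ := hC.1.contact
  refine ⟨fun w => α (fibreIncl w), hα.comp (ContDiff.smoothGerm fibreIncl.contDiff)
    (map_zero _), by simpa using hα0, ?_⟩
  have hdep := (hC.2.factor_dependsOnly hC.1.smooth h).eventually
  -- These two points differ only in s, which the factor does not see.
  have ht : Tendsto (fun y : JetZ m n => (incl y, fibreIncl (fibreBase y))) (𝓝 0)
      (𝓝 (0 : Jet m n) ×ˢ 𝓝 (0 : Jet m n)) := by
    refine tendsto_incl.prodMk ?_
    exact (fibreIncl.comp (fibreBase (m := m) (n := n))).continuous.tendsto' 0 0 (map_zero _)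
  filter_upwards [tendsto_incl.eventually h, ht.eventually hdep] with y hy hy' v
  rw [hy, hy' rfl]

/-- The pull-back of `Θ` by `c`. -/
noncomputable def pullback (c : JetZ m n → Jet m n) (y : JetZ m n) : JetZ m n →L[ℝ] ℝ :=
  (thetaL (c y)).comp (fderiv ℝ c y)

theorem SameJet.pullback {l : ℕ} {c c' : JetZ m n → Jet m n} (hc : SmoothGerm c)
    (hc' : SmoothGerm c') (h : SameJet (l + 1) c c') :
    SameJet l (RetLeg.pullback c) (RetLeg.pullback c') :=
  SameJet.bilinear hc.thetaL hc'.thetaL hc.fderiv hc'.fderiv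
    (ContinuousLinearMap.compL ℝ (JetZ m n) (Jet m n) ℝ)
    (SameJet.thetaL hc hc' (h.mono (Nat.le_succ l))) (sameJet_succ_iff.1 h).2

theorem SmoothGerm.pullback {c : JetZ m n → Jet m n} (hc : SmoothGerm c) :
    SmoothGerm (RetLeg.pullback c) :=
  hc.thetaL.bilinear hc.fderiv (ContinuousLinearMap.compL ℝ (JetZ m n) (Jet m n) ℝ)

/-- The linear map which reads off `(0, 0, s, p)` from the form `-∑ pᵢ dqᵢ - ∑ sᵢ dtᵢ`. -/
noncomputable def readCoeff : (JetZ m n →L[ℝ] ℝ) →L[ℝ] JetZ m n :=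
  ContinuousLinearMap.prod 0 (ContinuousLinearMap.prod 0 (ContinuousLinearMap.prod
    (ContinuousLinearMap.pi fun i =>
      -ContinuousLinearMap.apply ℝ ℝ ((Pi.single i 1, 0, 0, 0) : JetZ m n))
    (ContinuousLinearMap.pi fun i =>
      -ContinuousLinearMap.apply ℝ ℝ ((0, Pi.single i 1, 0, 0) : JetZ m n))))

/-- The linear projection `(t, q, s, p) ↦ (t, q, 0, 0)`. -/
noncomputable def horizontal : JetZ m n →L[ℝ] JetZ m n :=
  (ContinuousLinearMap.fst ℝ _ _).prod
    (((ContinuousLinearMap.fst ℝ _ _).comp (ContinuousLinearMap.snd ℝ _ _)).prod 0)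

/-- The rescaling is an affine function of the form η, so its jets are controlled by those of η
without dividing by coordinates to recover `b`. -/
theorem rescale_eq_readCoeff {b : ((Fin m → ℝ) × (Fin n → ℝ)) × (Fin n → ℝ) → ℝ}
    {η : JetZ m n →L[ℝ] ℝ} {y : JetZ m n}
    (h : ∀ v, η v = b (fibreBase y) * theta (incl y) (incl v)) :
    rescale b y = horizontal y + readCoeff η := by
  have h1 : ∀ i, η (Pi.single i 1, 0, 0, 0) = -(b (fibreBase y) * y.2.2.1 i) := fun i => by
    rw [h]; simp [theta, incl, Pi.single_apply]
  have h2 : ∀ i, η (0, Pi.single i 1, 0, 0) = -(b (fibreBase y) * y.2.2.2 i) := fun i => by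
    rw [h]; simp [theta, incl, Pi.single_apply]
  refine Prod.ext ?_ (Prod.ext ?_ (Prod.ext ?_ ?_))
  · simp [rescale, horizontal, readCoeff]
  · simp [rescale, horizontal, readCoeff]
  · ext i
    simp [rescale, horizontal, readCoeff, h1]
  · ext i
    simp [rescale, horizontal, readCoeff, h2]

theorem theta_add_smul_ez_left (x v : Jet m n) (c : ℝ) : theta (x + c • ez) v = theta x v := by
  have : pairing (ez : Jet m n) v = 0 := by simp [pairing_apply, ez]
  rw [theta_eq, theta_eq, map_add, map_smul, _root_.add_apply,
    _root_.smul_apply, this, smul_zero, add_zero]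

theorem tc_add_smul_ez (x : Jet m n) (c : ℝ) : tc (x + c • ez) = tc x := by
  change tc x + c • (0 : Fin m → ℝ) = tc x
  simp

theorem qc_add_smul_ez (x : Jet m n) (c : ℝ) : qc (x + c • ez) = qc x := by
  change qc x + c • (0 : Fin n → ℝ) = qc x
  simp

theorem zc_add_smul_ez (x : Jet m n) (c : ℝ) : zc (x + c • ez) = zc x + c := by
  change zc x + c * 1 = zc x + c
  simp

theorem sc_add_smul_ez (x : Jet m n) (c : ℝ) : sc (x + c • ez) = sc x := by
  change sc x + c • (0 : Fin m → ℝ) = sc x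
  simp

theorem pc_add_smul_ez (x : Jet m n) (c : ℝ) : pc (x + c • ez) = pc x := by
  change pc x + c • (0 : Fin n → ℝ) = pc x
  simp

theorem theta_incl_add (x v : Jet m n) :
    theta (incl (dropZ x)) (incl (dropZ v)) + zc v = theta x v := by
  simp only [theta, incl, dropZ, zc_mk, pc_mk, qc_mk, sc_mk, tc_mk]
  ring

theorem mem_CTTheta {D : Jet m n → Jet m n} (hD : SmoothGerm D) (hP : HasPForm D)
    (h : ∀ᶠ x in 𝓝 (0 : Jet m n), ∀ v, theta (D x) (fderiv ℝ D x v) = theta x v) :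
    D ∈ CTTheta m n :=
  ⟨⟨⟨hD, injective_fderiv_of_theta hD.contDiffAt h, fun _ => 1,
    ContDiff.smoothGerm contDiff_const, one_ne_zero, by simpa using h⟩, hP⟩, h⟩

theorem SmoothGerm.comp_incl {C : Jet m n → Jet m n} (hC : SmoothGerm C) :
    SmoothGerm (fun y => C (incl y)) :=
  hC.comp (ContDiff.smoothGerm (inclL (m := m) (n := n)).contDiff) rfl

theorem fderiv_comp_incl {C : Jet m n → Jet m n} (hC : SmoothGerm C) :
    ∀ᶠ y in 𝓝 (0 : JetZ m n), ∀ v,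
      fderiv ℝ (fun y => C (incl y)) y v = fderiv ℝ C (incl y) (incl v) := by
  filter_upwards [tendsto_incl.eventually hC.eventually_differentiableAt] with y hy v
  exact congrArg (fun A => A v)
    (hy.hasFDerivAt.comp y (inclL (m := m) (n := n)).hasFDerivAt).fderiv

/-- A `𝒫`-contact germ can be reparametrized on `{z = 0}` so as to preserve `Θ`. -/
theorem exists_normalForm {C : Jet m n → Jet m n} (hC : C ∈ CT m n) :
    ∃ D ∈ CTTheta m n, ∃ b κ : ((Fin m → ℝ) × (Fin n → ℝ)) × (Fin n → ℝ) → ℝ,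
      SmoothGerm b ∧ SmoothGerm κ ∧
      (∀ᶠ y in 𝓝 (0 : JetZ m n), rescale b (rescale κ y) = y) ∧
      (∀ᶠ y in 𝓝 (0 : JetZ m n), rescale κ (rescale b y) = y) ∧
      (∀ᶠ y in 𝓝 (0 : JetZ m n),
        rescale b y = horizontal y + readCoeff (pullback (fun y => C (incl y)) y)) ∧
      ∀ᶠ y in 𝓝 (0 : JetZ m n), D (incl y) = C (incl (rescale κ y)) := by
  obtain ⟨b, hb, hb0, hbC⟩ := exists_factor_on_zero hC
  obtain ⟨κ, hκ, -, hκb, hbκ⟩ := exists_inverse_rescaling hb hb0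
  have hCs := hC.1.smooth
  have hρ : SmoothGerm (rescale κ : JetZ m n → JetZ m n) := hκ.rescale
  have hρt : Tendsto (rescale κ) (𝓝 (0 : JetZ m n)) (𝓝 0) := by
    simpa [ContinuousAt, rescale_zero] using hρ.continuousAt
  have hdt : Tendsto (dropZ : Jet m n → JetZ m n) (𝓝 0) (𝓝 0) :=
    (dropL (m := m) (n := n)).continuous.tendsto 0
  have hinv := rescale_rescale hκb
  have hF : SmoothGerm fun x : Jet m n => incl (rescale κ (dropZ x)) :=
    (hρ.comp (ContDiff.smoothGerm (dropL (m := m) (n := n)).contDiff) rfl).clm inclL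
  have hF0 : incl (rescale κ (dropZ (0 : Jet m n))) = 0 := by
    rw [dropZ_zero, rescale_zero, incl_zero]
  have hFt : Tendsto (fun x : Jet m n => incl (rescale κ (dropZ x))) (𝓝 0) (𝓝 0) := by
    have := hF.continuousAt.tendsto
    rwa [hF0] at this
  -- Translation equivariance in z is necessary for a germ preserving Θ; it fixes the continuation
  -- of C ∘ ρ_κ off {z = 0}.
  let D : Jet m n → Jet m n := fun x => C (incl (rescale κ (dropZ x))) + zc x • ez
  have hDs : SmoothGerm D :=
    (hCs.comp hF hF0).add (ContDiff.smoothGerm ((zcL (m := m) (n := n)).smulRight ez).contDiff)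
  have hDt : ∀ᶠ x in 𝓝 (0 : Jet m n), ∀ v, theta (D x) (fderiv ℝ D x v) = theta x v := by
    filter_upwards [hFt.eventually hCs.eventually_differentiableAt,
      hdt.eventually hρ.eventually_differentiableAt, hdt.eventually (fderiv_rescale_fst hκ),
      hdt.eventually (hρt.eventually hbC), hdt.eventually hinv] with x h1 h2 h3 h4 h5 v
    have hd : HasFDerivAt D _ x := (h1.hasFDerivAt.comp x
      ((inclL (m := m) (n := n)).hasFDerivAt.comp x
        (h2.hasFDerivAt.comp x (dropL (m := m) (n := n)).hasFDerivAt))).add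
      ((zcL (m := m) (n := n)).smulRight ez).hasFDerivAt
    have hdv : fderiv ℝ D x v = fderiv ℝ C (incl (rescale κ (dropZ x)))
        (incl (fderiv ℝ (rescale κ) (dropZ x) (dropZ v))) + zc v • ez := by
      rw [hd.fderiv]; rfl
    -- At the rescaled point the factor `b` of `C` is exactly what ρ_b ∘ ρ_κ = id compensates.
    have h6 : theta (incl (dropZ x)) (incl (dropZ v)) =
        b (fibreBase (rescale κ (dropZ x))) * theta (incl (rescale κ (dropZ x)))
          (incl (fderiv ℝ (rescale κ) (dropZ x) (dropZ v))) := by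
      have := theta_rescale (b := b) (y := rescale κ (dropZ x)) (h3 (dropZ v)).1.symm
        (h3 (dropZ v)).2.symm
      rwa [h5] at this
    rw [hdv, theta_add_smul_ez_left, ← thetaL_apply, map_add, map_smul, thetaL_apply, thetaL_apply,
      theta_ez, h4, ← h6, smul_eq_mul, mul_one, theta_incl_add]
  refine ⟨D, mem_CTTheta hDs ?_ hDt, b, κ, hb, hκ, hinv, rescale_rescale hbκ, ?_, ?_⟩
  · have hbase : ∀ᶠ p in 𝓝 (0 : Jet m n) ×ˢ 𝓝 (0 : Jet m n), base p.1 = base p.2 →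
        base (incl (rescale κ (dropZ p.1))) = base (incl (rescale κ (dropZ p.2))) := by
      refine Eventually.of_forall fun p h => ?_
      simp only [base, Prod.mk.injEq] at h
      simp only [base, incl, rescale, dropZ, fibreBase_apply, tc_mk, qc_mk, zc_mk, pc_mk]
      rw [h.1, h.2.1, h.2.2.2]
    refine ⟨?_, ?_, ?_, fun i => ?_, ?_⟩
    · filter_upwards [hFt.eventually hC.2.t_eq] with x hx
      rw [tc_add_smul_ez, hx]
      rfl
    · exact (hC.2.q_dep.comp_tendsto hFt hbase).congr
        (Eventually.of_forall fun x => (qc_add_smul_ez _ _).symm)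
    · have h := (hC.2.z_dep.comp_tendsto hFt hbase).eventually
      rw [dependsOnly_iff]
      filter_upwards [h] with p hp hb
      have hz : zc p.1 = zc p.2 := congrArg (fun a => a.2.2.1) hb
      rw [zc_add_smul_ez, zc_add_smul_ez, hp hb, hz]
    · refine ((hC.2.s_dep i).comp_tendsto (c' := baseS i) hFt ?_).congr
        (Eventually.of_forall fun x => congrFun (sc_add_smul_ez _ _).symm i)
      refine Eventually.of_forall fun p h => ?_
      simp only [Prod.mk.injEq] at h
      simp only [incl, rescale, dropZ, fibreBase_apply, tc_mk, qc_mk, zc_mk, pc_mk, sc_mk,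
        Pi.smul_apply]
      rw [h.1, h.2.1, h.2.2.2.1, h.2.2.2.2]
    · exact (hC.2.p_dep.comp_tendsto hFt hbase).congr
        (Eventually.of_forall fun x => (pc_add_smul_ez _ _).symm)
  · filter_upwards [hbC, fderiv_comp_incl hCs] with y hy hy'
    refine rescale_eq_readCoeff fun v => ?_
    rw [← hy v, ← hy' v]
    rw [pullback, ContinuousLinearMap.comp_apply, thetaL_apply]
  · refine Eventually.of_forall fun y => ?_
    change C (incl (rescale κ y)) + (0 : ℝ) • ez = _
    rw [zero_smul, add_zero]
end NormalForm

/-! ### Lifting contact germs through germs that preserve Θ -/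

section Lift

theorem SmoothGerm.tendsto_zero {E F : Type} [NormedAddCommGroup E] [NormedSpace ℝ E]
    [NormedAddCommGroup F] [NormedSpace ℝ F] {f : E → F} (hf : SmoothGerm f) (h0 : f 0 = 0) :
    Tendsto f (𝓝 0) (𝓝 0) := by
  have := hf.continuousAt.tendsto
  rwa [h0] at this

/-- A contact germ lifts through a germ that preserves `Θ`. -/
theorem exists_contact_lift {D C : Jet m n → Jet m n} (hD : D ∈ CTTheta m n)
    (hC : C ∈ CT m n) (h0 : C 0 = D 0) :
    ∃ Φ : Jet m n → Jet m n, IsContactDiffeo Φ ∧ (∀ᶠ x in 𝓝 (0 : Jet m n), D (Φ x) = C x) ∧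
      (∀ᶠ x in 𝓝 (0 : Jet m n), tc (Φ x) = tc x) ∧
      ∀ᶠ x in 𝓝 (0 : Jet m n), ∀ v, theta (Φ x) (fderiv ℝ Φ x v) = theta (C x) (fderiv ℝ C x v) := by
  have hDs := hD.1.1.smooth
  obtain ⟨Φ, hΦ, hΦ0, hDΦ⟩ := hDs.exists_lift hD.1.1.immersive hC.1.smooth h0
  have ht := hΦ.tendsto_zero hΦ0
  have hder : ∀ᶠ x in 𝓝 (0 : Jet m n),
      ∀ v, fderiv ℝ C x v = fderiv ℝ D (Φ x) (fderiv ℝ Φ x v) := by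
    filter_upwards [hDΦ.eventually_nhds, hΦ.eventually_differentiableAt,
      ht.eventually hDs.eventually_differentiableAt] with x h1 h2 h3 v
    have h4 : (fun x => D (Φ x)) =ᶠ[𝓝 x] C := h1
    rw [← h4.fderiv_eq, fderiv_fun_comp x h3 h2]
    rfl
  have hθ : ∀ᶠ x in 𝓝 (0 : Jet m n), ∀ v,
      theta (Φ x) (fderiv ℝ Φ x v) = theta (C x) (fderiv ℝ C x v) := by
    filter_upwards [hder, hDΦ, ht.eventually hD.2] with x h1 h2 h3 v
    rw [h1, ← h2, h3]
  refine ⟨Φ, ⟨⟨hΦ, ?_, ?_⟩, hΦ0⟩, hDΦ, ?_, hθ⟩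
  · intro v w hvw
    apply hC.1.immersive
    rw [hder.self_of_nhds, hder.self_of_nhds, hvw]
  · obtain ⟨α, hα, hα0, h⟩ := hC.1.contact
    refine ⟨α, hα, hα0, ?_⟩
    filter_upwards [h, hθ] with x h1 h2 v
    rw [h2, h1]
  · filter_upwards [hDΦ, ht.eventually hD.1.2.t_eq, hC.2.t_eq] with x h1 h2 h3
    rw [← h2, h1, h3]

theorem HasPForm.base_eventually {C : Jet m n → Jet m n} (hP : HasPForm C) :
    ∀ᶠ p in 𝓝 (0 : Jet m n) ×ˢ 𝓝 (0 : Jet m n),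
      base p.1 = base p.2 → base (C p.1) = base (C p.2) := by
  filter_upwards [hP.t_eq.prod_mk hP.t_eq, hP.q_dep.eventually, hP.z_dep.eventually,
    hP.p_dep.eventually] with p ht hq hz hp h
  have h1 : tc p.1 = tc p.2 := (Prod.ext_iff.1 h).1
  simp only [base, Prod.mk.injEq]
  exact ⟨by rw [ht.1, ht.2, h1], hq h, hz h, hp h⟩

theorem base_of_baseS {i : Fin m} {x y : Jet m n} (h : baseS i x = baseS i y) :
    base x = base y := by
  simp only [baseS, Prod.mk.injEq] at h
  simp only [base, Prod.mk.injEq]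
  exact ⟨h.1, h.2.1, h.2.2.1, h.2.2.2.2⟩

/-- A germ `F` with `D ∘ F = E` has the special form when `D` and `E` are in `C_T^Θ`. -/
theorem hasPForm_of_comp {D E F : Jet m n → Jet m n} (hD : D ∈ CTTheta m n)
    (hE : E ∈ CTTheta m n) (hF : Tendsto F (𝓝 0) (𝓝 0))
    (hDF : ∀ᶠ x in 𝓝 (0 : Jet m n), D (F x) = E x)
    (ht : ∀ᶠ x in 𝓝 (0 : Jet m n), tc (F x) = tc x) : HasPForm F := by
  obtain ⟨U, hU, hinj⟩ := hD.1.1.smooth.eventually_injective hD.1.1.immersive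
  -- Correct the s-coordinate of `F p.1` by the difference of the s-components of `E`. As `D`
  -- changes s only by a function of the other coordinates, `D` sends the corrected point and `F
  -- p.2` to the same image whenever the bases of `p.1` and `p.2` agree; injectivity identifies the
  -- two points.
  let σ : Jet m n × Jet m n → Jet m n := fun p =>
    F p.1 + (0, 0, 0, sc (E p.2) - sc (E p.1), 0)
  have hσ : Tendsto σ (𝓝 0 ×ˢ 𝓝 0) (𝓝 0) := by
    have hs : Tendsto (fun x => sc (E x)) (𝓝 0) (𝓝 (sc (E 0))) :=
      ((scL (m := m) (n := n)).continuous.tendsto _).comp hE.1.1.smooth.continuousAt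
    have h1 : Tendsto (fun p : Jet m n × Jet m n => sc (E p.2) - sc (E p.1)) (𝓝 0 ×ˢ 𝓝 0)
        (𝓝 (sc (E 0) - sc (E 0))) := (hs.comp tendsto_snd).sub (hs.comp tendsto_fst)
    rw [sub_self] at h1
    have h2 : Tendsto (fun s : Fin m → ℝ => ((0, 0, 0, s, 0) : Jet m n)) (𝓝 0) (𝓝 0) :=
      (by fun_prop : Continuous fun s : Fin m → ℝ => ((0, 0, 0, s, 0) : Jet m n)).tendsto' 0 0 rfl
    simpa using (hF.comp tendsto_fst).add (h2.comp h1)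
  have hbσ : ∀ p, base (σ p) = base (F p.1) := fun p => by
    simp only [base, Prod.mk.injEq]
    exact ⟨add_zero _, add_zero _, add_zero _, add_zero _⟩
  have hsσ : ∀ p, sc (σ p) = sc (F p.1) + (sc (E p.2) - sc (E p.1)) := fun p => rfl
  have hs := eventually_all.2 fun i => (sc_sub_dependsOnly hD i).eventually
  have key : ∀ᶠ p in 𝓝 (0 : Jet m n) ×ˢ 𝓝 (0 : Jet m n),
      base p.1 = base p.2 → base (F p.1) = base (F p.2) := by
    filter_upwards [(hσ.prodMk (hF.comp tendsto_fst)).eventually hs,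
      (hσ.prodMk (hF.comp tendsto_fst)).eventually hD.1.2.base_eventually,
      hE.1.2.base_eventually, hDF.prod_mk hDF, hσ.eventually hU,
      (hF.comp tendsto_snd).eventually hU] with p h1 h2 h3 h4 h5 h6 h
    have h7 : base (D (σ p)) = base (D (F p.2)) := by
      rw [h2 (hbσ p)]
      simp only [Function.comp_apply]
      rw [h4.1, h4.2, h3 h]
    have h8 : sc (D (σ p)) = sc (D (F p.2)) := by
      ext i
      have := h1 i (hbσ p)
      simp only [Function.comp_apply] at this
      rw [hsσ, h4.1] at this
      rw [h4.2]
      simp only [Pi.add_apply, Pi.sub_apply] at this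
      linarith
    simp only [base, Prod.mk.injEq] at h7
    have h9 : σ p = F p.2 := hinj h5 h6 (jet_ext h7.1 h7.2.1 h7.2.2.1 h8 h7.2.2.2)
    rw [← hbσ, h9]
  refine ⟨ht, ?_, ?_, fun i => ?_, ?_⟩
  · exact dependsOnly_iff.2 (key.mono fun p hp h => congrArg (fun a => a.2.1) (hp h))
  · exact dependsOnly_iff.2 (key.mono fun p hp h => congrArg (fun a => a.2.2.1) (hp h))
  -- The i-th s-component of `F` is that of `E` minus a function of the base of `F`, already known
  -- to depend only on the base.
  · rw [dependsOnly_iff]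
    filter_upwards [key, (hF.prodMap hF).eventually hs, hDF.prod_mk hDF,
      (hE.1.2.s_dep i).eventually] with p h1 h2 h3 h4 h
    have h5 := h2 i (h1 (base_of_baseS h))
    have h6 := h4 h
    simp only [Prod.map_fst, Prod.map_snd] at h5
    rw [h3.1, h3.2] at h5
    linarith
  · exact dependsOnly_iff.2 (key.mono fun p hp h => congrArg (fun a => a.2.2.2) (hp h))

theorem comp_mem_CTTheta {D F : Jet m n → Jet m n} (hD : D ∈ CTTheta m n)
    (hF : F ∈ CTTheta m n) (hF0 : F 0 = 0) : (fun x => D (F x)) ∈ CTTheta m n := by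
  have hFs := hF.1.1.smooth
  have hDs := hD.1.1.smooth
  have ht := hFs.tendsto_zero hF0
  have hb := hF.1.2.base_eventually
  refine mem_CTTheta (hDs.comp hFs hF0) ⟨?_, ?_, ?_, fun i => ?_, ?_⟩ ?_
  · filter_upwards [ht.eventually hD.1.2.t_eq, hF.1.2.t_eq] with x h1 h2
    rw [h1, h2]
  · exact hD.1.2.q_dep.comp_tendsto ht hb
  · exact hD.1.2.z_dep.comp_tendsto ht hb
  · refine (hD.1.2.s_dep i).comp_tendsto (c' := baseS i) ht ?_
    filter_upwards [hb, (hF.1.2.s_dep i).eventually] with p h1 h2 h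
    have h3 := h1 (base_of_baseS h)
    have h4 := h2 h
    simp only [base, Prod.mk.injEq] at h3
    simp only [Prod.mk.injEq]
    exact ⟨h3.1, h3.2.1, h3.2.2.1, h4, h3.2.2.2⟩
  · exact hD.1.2.p_dep.comp_tendsto ht hb
  · filter_upwards [ht.eventually hD.2, hF.2, hFs.eventually_differentiableAt,
      ht.eventually hDs.eventually_differentiableAt] with x h1 h2 h3 h4 v
    rw [fderiv_fun_comp x h4 h3, ContinuousLinearMap.comp_apply, h1, h2]

theorem IsContactDiffeo.comp {Ψ Φ : Jet m n → Jet m n} (hΨ : IsContactDiffeo Ψ)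
    (hΦ : IsContactDiffeo Φ) : IsContactDiffeo (fun x => Ψ (Φ x)) := by
  have ht := hΦ.smooth.tendsto_zero hΦ.map_zero
  have hd : ∀ᶠ x in 𝓝 (0 : Jet m n), ∀ v,
      fderiv ℝ (fun x => Ψ (Φ x)) x v = fderiv ℝ Ψ (Φ x) (fderiv ℝ Φ x v) := by
    filter_upwards [hΦ.smooth.eventually_differentiableAt,
      ht.eventually hΨ.smooth.eventually_differentiableAt] with x h1 h2 v
    rw [fderiv_fun_comp x h2 h1]
    rfl
  refine ⟨⟨hΨ.smooth.comp hΦ.smooth hΦ.map_zero, ?_, ?_⟩, ?_⟩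
  · intro v w hvw
    rw [hd.self_of_nhds, hd.self_of_nhds, hΦ.map_zero] at hvw
    exact hΦ.immersive (hΨ.immersive hvw)
  · obtain ⟨α, hα, hα0, h⟩ := hΨ.contact
    obtain ⟨β, hβ, hβ0, h'⟩ := hΦ.contact
    refine ⟨fun x => α (Φ x) * β x, ?_, ?_, ?_⟩
    · filter_upwards [hα.comp hΦ.smooth hΦ.map_zero, hβ] with x h1 h2
      exact h1.mul h2
    · simp [hΦ.map_zero, hα0, hβ0]
    · filter_upwards [hd, ht.eventually h, h'] with x h1 h2 h3 v
      rw [h1, h2, h3, mul_assoc]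
  · rw [hΦ.map_zero, hΨ.map_zero]

end Lift

/-! ### Comparison of the notions of determinacy -/

section Determinacy

variable {r : ℕ}

theorem PLegendrianEquivalent.congr {L₁ L₁' L₂ : Jet m n → Jet m n}
    (h : PLegendrianEquivalent r L₁ L₂) (he : ∀ᶠ x in 𝓝[corner m n r] 0, L₁ x = L₁' x) :
    PLegendrianEquivalent r L₁' L₂ := by
  obtain ⟨K, Ψ, hK, hΨ, h⟩ := h
  refine ⟨K, Ψ, hK, hΨ, ?_⟩
  filter_upwards [h, he] with x h1 h2
  rw [← h2, h1]

theorem PreservesFaces.eventually_corner {χ : JetZ m n → JetZ m n} (hχ : PreservesFaces r χ)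
    {P : Jet m n → Prop} (h : ∀ᶠ x in 𝓝[corner m n r] 0, P x) :
    ∀ᶠ x in 𝓝[corner m n r] 0, P (incl (χ (dropZ x))) :=
  eventually_corner_iff.2 fun σ => (hχ.tendsto σ).eventually (eventually_corner_iff.1 h σ)

/-- The face filter contains the point 0 itself, so convergence of the images to 0 pins the value
there. -/
theorem PreservesFaces.map_zero {χ : JetZ m n → JetZ m n} (hχ : PreservesFaces r χ) : χ 0 = 0 := by
  by_contra hne
  have h1 : ∀ᶠ x in 𝓝 (0 : Jet m n), x ≠ incl (χ 0) := by
    refine isOpen_ne.mem_nhds fun h => hne ?_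
    have h2 := congrArg dropZ h
    rw [dropZ_incl, dropZ_zero] at h2
    exact h2.symm
  have h2 := (hχ.tendsto ∅).eventually (eventually_nhdsWithin_of_eventually_nhds h1)
  exact h2.self_of_nhdsWithin (zero_mem_face r ∅) rfl

/-- Germs that differ by a face-preserving reparametrization of `{z = 0}` are equivalent. -/
theorem PLegendrianEquivalent.of_reparametrization {C D L : Jet m n → Jet m n}
    (hC : C ∈ CT m n) (hD : D ∈ CTTheta m n) {χ : JetZ m n → JetZ m n}
    (hχ : PreservesFaces r χ)
    (h : ∀ᶠ x in 𝓝[corner m n r] 0, D (incl (χ (dropZ x))) = C x)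
    (hDL : PLegendrianEquivalent r D L) : PLegendrianEquivalent r C L := by
  have h0 : C 0 = D 0 := by
    have := h.self_of_nhdsWithin (zero_mem_corner r)
    rw [← this, dropZ_zero, hχ.map_zero, incl_zero]
  obtain ⟨Φ, hΦ, hDΦ, hΦt, -⟩ := exists_contact_lift hD hC h0
  have ht := hΦ.smooth.tendsto_zero hΦ.map_zero
  obtain ⟨U, hU, hinj⟩ := hD.1.1.smooth.eventually_injective hD.1.1.immersive
  -- Φ = D⁻¹ ∘ C is a contact germ that continues χ off the corner; both have the same image under
  -- the injective `D`.
  have hΦχ : ∀ᶠ x in 𝓝[corner m n r] 0, incl (χ (dropZ x)) = Φ x := by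
    filter_upwards [h, eventually_nhdsWithin_of_eventually_nhds hDΦ,
      eventually_nhdsWithin_of_eventually_nhds (ht.eventually hU),
      hχ.eventually_corner (eventually_nhdsWithin_of_eventually_nhds hU)] with x h1 h2 h3 h4
    exact hinj h4 h3 (h1.trans h2.symm)
  have hpres : ∀ σ : Set (Fin n), map Φ (𝓝[face r σ] 0) = 𝓝[face r σ] 0 := fun σ => by
    refine (Filter.map_congr ?_).trans (hχ σ)
    filter_upwards [eventually_corner_iff.1 hΦχ σ] with x hx
    exact hx.symm
  obtain ⟨K, Ψ, hK, hΨ, hKΨ⟩ := hDL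
  refine ⟨K, fun x => Ψ (Φ x), hK, ⟨hΨ.toIsContactDiffeo.comp hΦ, ?_, fun σ => ?_⟩, ?_⟩
  · obtain ⟨g, hg⟩ := hΨ.t_dep
    refine ⟨g, ?_⟩
    filter_upwards [ht.eventually hg, hΦt] with x h1 h2
    rw [h1, h2]
  · conv_rhs => rw [← hΨ.preserves σ, ← hpres σ, map_map]
    rfl
  · filter_upwards [hχ.eventually_corner hKΨ, hΦχ, h] with x h1 h2 h3
    rw [← h3, h1, h2]

/-- Each germ is its restriction to {z = 0} followed by translation in z, so no order is lost. -/
theorem SameJet.of_comp_incl {l : ℕ} {D D' : Jet m n → Jet m n} (hD : D ∈ CTTheta m n)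
    (hD' : D' ∈ CTTheta m n) (h : SameJet l (fun y => D (incl y)) (fun y => D' (incl y))) :
    SameJet l D D' := by
  have hdrop : SmoothGerm (dropZ : Jet m n → JetZ m n) :=
    ContDiff.smoothGerm (dropL (m := m) (n := n)).contDiff
  have hz : SmoothGerm fun x : Jet m n => zc x • (ez : Jet m n) :=
    ContDiff.smoothGerm ((zcL (m := m) (n := n)).smulRight ez).contDiff
  have hs := hD.1.1.smooth.comp_incl
  have hs' := hD'.1.1.smooth.comp_incl
  have h1 : SameJet l (fun x => D (incl (dropZ x))) (fun x => D' (incl (dropZ x))) :=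
    SameJet.comp (g := fun y => D (incl y)) (g' := fun y => D' (incl y)) hs hs' hdrop hdrop rfl h (SameJet.refl _ _)
  have h2 := SameJet.add (hs.comp hdrop rfl) (hs'.comp hdrop rfl) hz hz h1 (SameJet.refl _ _)
  exact (SameJet.of_eventuallyEq (eventually_eq_add_of_theta hD.1.1.smooth hD.2) l).trans
    (h2.trans (SameJet.of_eventuallyEq (eventually_eq_add_of_theta hD'.1.1.smooth hD'.2) l).symm)

/-- Normal forms of germs with the same `(l + 1)`-jet on `{z = 0}` have the same `l`-jet. -/
theorem exists_normalForm_pair (r : ℕ) {l : ℕ} {C C' : Jet m n → Jet m n} (hC : C ∈ CT m n)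
    (hC' : C' ∈ CT m n)
    (h : SameJet (l + 1) (fun y => C (incl y)) (fun y => C' (incl y))) :
    ∃ D ∈ CTTheta m n, ∃ D' ∈ CTTheta m n, ∃ φ ψ φ' : JetZ m n → JetZ m n,
      PreservesFaces r φ ∧ PreservesFaces r ψ ∧ PreservesFaces r φ' ∧
      (∀ᶠ y in 𝓝 (0 : JetZ m n), φ (ψ y) = y) ∧
      (∀ᶠ y in 𝓝 (0 : JetZ m n), D (incl y) = C (incl (ψ y))) ∧
      (∀ᶠ y in 𝓝 (0 : JetZ m n), D (incl (φ y)) = C (incl y)) ∧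
      (∀ᶠ y in 𝓝 (0 : JetZ m n), D' (incl (φ' y)) = C' (incl y)) ∧
      SameJet l (fun y => D (incl y)) (fun y => D' (incl y)) := by
  obtain ⟨D, hD, b, κ, hb, hκ, hbκ, hκb, hread, hDC⟩ := exists_normalForm hC
  obtain ⟨D', hD', b', κ', hb', hκ', hbκ', hκb', hread', hDC'⟩ := exists_normalForm hC'
  have hs := hC.1.smooth.comp_incl
  have hs' := hC'.1.smooth.comp_incl
  have hjet : SameJet l (rescale (m := m) b) (rescale b') := by
    have hh : SmoothGerm (horizontal : JetZ m n → JetZ m n) :=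
      ContDiff.smoothGerm horizontal.contDiff
    exact (SameJet.of_eventuallyEq hread l).trans ((SameJet.add hh hh (hs.pullback.clm readCoeff)
      (hs'.pullback.clm readCoeff) (SameJet.refl _ _)
      (SameJet.clm hs.pullback hs'.pullback readCoeff (SameJet.pullback hs hs' h))).trans
      (SameJet.of_eventuallyEq hread' l).symm)
  have hjet' : SameJet l (rescale (m := m) κ) (rescale κ') :=
    SameJet.inverse hb.rescale hb'.rescale hκ.rescale hκ'.rescale rescale_zero rescale_zero
      hκb hbκ' hjet
  refine ⟨D, hD, D', hD', rescale b, rescale κ, rescale b', preservesFaces_rescale hb hκ hbκ r,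
    preservesFaces_rescale hκ hb hκb r, preservesFaces_rescale hb' hκ' hbκ' r, hbκ, hDC, ?_, ?_, ?_⟩
  · filter_upwards [(hb.rescale.tendsto_zero rescale_zero).eventually hDC, hκb] with y h1 h2
    rw [h1, h2]
  · filter_upwards [(hb'.rescale.tendsto_zero rescale_zero).eventually hDC', hκb'] with y h1 h2
    rw [h1, h2]
  · exact (SameJet.of_eventuallyEq hDC l).trans ((SameJet.comp hs hs' hκ.rescale hκ'.rescale
      rescale_zero (h.mono (Nat.le_succ l)) hjet').trans (SameJet.of_eventuallyEq hDC' l).symm)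

/-- A notion of extension that depends only on the germ on the corner. -/
def CornerInvariant (r : ℕ) (Ext : (Jet m n → Jet m n) → (Jet m n → Jet m n) → Prop) : Prop :=
  ∀ L C C', (∀ᶠ x in 𝓝[corner m n r] 0, C x = C' x) → Ext L C → Ext L C'

theorem cornerInvariant_extends : CornerInvariant r (Extends (m := m) (n := n) r) := by
  intro L C C' h hC
  filter_upwards [h, hC] with x h1 h2
  rw [← h1, h2]

theorem cornerInvariant_defines : CornerInvariant r (Defines (m := m) (n := n) r) := by
  intro L C C' h hC σ
  rw [← hC σ]
  exact map_congr ((eventually_corner_iff.1 h σ).mono fun x hx => hx.symm)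

theorem eventually_corner_of_eventually_zero {P : JetZ m n → Prop}
    (h : ∀ᶠ y in 𝓝 (0 : JetZ m n), P y) : ∀ᶠ x in 𝓝[corner m n r] 0, P (dropZ x) :=
  eventually_corner_iff.2 fun σ => (tendsto_dropZ r σ).eventually h

/-- On the corner a germ restricted to `{z = 0}` agrees with the original germ. -/
theorem eventually_comp_dropZ {C : Jet m n → Jet m n} {c : JetZ m n → Jet m n}
    (h : ∀ᶠ y in 𝓝 (0 : JetZ m n), c y = C (incl y)) :
    ∀ᶠ x in 𝓝[corner m n r] 0, (c ∘ dropZ) x = C x := by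
  filter_upwards [eventually_corner_of_eventually_zero h, eventually_corner_zc r] with x h1 h2
  rw [Function.comp_apply, h1, incl_dropZ h2]

variable {Ext : (Jet m n → Jet m n) → (Jet m n → Jet m n) → Prop} {l : ℕ} {L : Jet m n → Jet m n}

theorem Determined.determinedTheta (h : Determined r Ext l L) : DeterminedTheta r Ext l L :=
  fun C hC hL C' hC' hj => h C hC.1 hL C' hC'.1 hj

theorem DeterminedTheta.determinedThetaZ (hExt : CornerInvariant r Ext)
    (h : DeterminedTheta r Ext l L) : DeterminedThetaZ r Ext l L := by
  rintro c ⟨C, hC, hcC⟩ hL c' ⟨C', hC', hcC'⟩ hj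
  have hj' : SameJet l C C' := SameJet.of_comp_incl hC hC'
    ((SameJet.of_eventuallyEq hcC l).symm.trans (hj.trans (SameJet.of_eventuallyEq hcC' l)))
  exact (h C hC (hExt _ _ _ (eventually_comp_dropZ hcC) hL) C' hC' hj').congr
    ((eventually_comp_dropZ hcC').mono fun x hx => hx.symm)

theorem DeterminedZ.determined (hExt : CornerInvariant r Ext)
    (h : DeterminedZ r Ext l L) : Determined r Ext l L := by
  intro C hC hL C' hC' hj
  have hC0 : ∀ C : Jet m n → Jet m n, ∀ᶠ y in 𝓝 (0 : JetZ m n),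
      (fun y => C (incl y)) y = C (incl y) := fun C => Eventually.of_forall fun _ => rfl
  have hi : SmoothGerm (incl : JetZ m n → Jet m n) :=
    ContDiff.smoothGerm (inclL (m := m) (n := n)).contDiff
  have hj' : SameJet l (fun y => C (incl y)) (fun y => C' (incl y)) :=
    SameJet.comp hC.1.smooth hC'.1.smooth hi hi rfl hj (SameJet.refl _ _)
  exact (h _ ⟨C, hC, hC0 C⟩ (hExt _ _ _ ((eventually_comp_dropZ (hC0 C)).mono fun x hx => hx.symm)
    hL) _ ⟨C', hC', hC0 C'⟩ hj').congr (eventually_comp_dropZ (hC0 C'))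

theorem mem_CTThetaZ {D : Jet m n → Jet m n} (hD : D ∈ CTTheta m n) :
    (fun y => D (incl y)) ∈ CTThetaZ m n :=
  ⟨D, hD, Eventually.of_forall fun _ => rfl⟩

theorem eventually_comp_incl_dropZ (D : Jet m n → Jet m n) :
    ∀ᶠ x in 𝓝[corner m n r] 0, ((fun y => D (incl y)) ∘ dropZ) x = D x :=
  eventually_comp_dropZ (Eventually.of_forall fun _ => rfl)

theorem DeterminedThetaZ.determinedZ_defines (h : DeterminedThetaZ r (Defines r) l L) :
    DeterminedZ r (Defines r) (l + 1) L := by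
  rintro c ⟨C, hC, hcC⟩ hL c' ⟨C', hC', hcC'⟩ hj
  obtain ⟨D, hD, D', hD', φ, ψ, φ', -, hψ, hφ', -, hDC, -, hDC', hDj⟩ :=
    exists_normalForm_pair r hC hC' ((SameJet.of_eventuallyEq hcC _).symm.trans
      (hj.trans (SameJet.of_eventuallyEq hcC' _)))
  -- `D` is `C` precomposed with the face-preserving ψ, so the images of the faces agree although
  -- the parametrizations need not.
  have hDL : Defines r L ((fun y => D (incl y)) ∘ dropZ) := by
    intro σ
    rw [← cornerInvariant_defines _ _ _ (eventually_comp_dropZ hcC) hL σ]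
    conv_rhs => rw [← hψ σ, map_map]
    refine Filter.map_congr ?_
    filter_upwards [(tendsto_dropZ r σ).eventually hDC] with x hx
    exact hx
  have hD'L := (h _ (mem_CTThetaZ hD) hDL _ (mem_CTThetaZ hD') hDj).congr
    (eventually_comp_incl_dropZ D')
  refine (PLegendrianEquivalent.of_reparametrization hC' hD' hφ' ?_ hD'L).congr
    ((eventually_comp_dropZ hcC').mono fun x hx => hx.symm)
  filter_upwards [eventually_corner_of_eventually_zero hDC', eventually_corner_zc r] with x h1 h2
  rw [h1, incl_dropZ h2]

theorem DeterminedThetaZ.determinedZ_extends (hE : ∃ E ∈ CTTheta m n, Extends r L E)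
    (h : DeterminedThetaZ r (Extends r) l L) : DeterminedZ r (Extends r) (l + 1) L := by
  obtain ⟨E, hE, hEL⟩ := hE
  rintro c ⟨C, hC, hcC⟩ hL c' ⟨C', hC', hcC'⟩ hj
  obtain ⟨D, hD, D', hD', φ, ψ, φ', hφ, hψ, hφ', hφψ, -, hDC, hDC', hDj⟩ :=
    exists_normalForm_pair r hC hC' ((SameJet.of_eventuallyEq hcC _).symm.trans
      (hj.trans (SameJet.of_eventuallyEq hcC' _)))
  have hCL : Extends r L C := cornerInvariant_extends _ _ _ (eventually_comp_dropZ hcC) hL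
  have hDE : ∀ᶠ x in 𝓝[corner m n r] 0, D (incl (φ (dropZ x))) = E x := by
    filter_upwards [eventually_corner_of_eventually_zero hDC, eventually_corner_zc r, hCL, hEL]
      with x h1 h2 h3 h4
    rw [h1, incl_dropZ h2, h3, h4]
  have h0 : E 0 = D 0 := by
    have := hDE.self_of_nhdsWithin (zero_mem_corner r)
    rw [← this, dropZ_zero, hφ.map_zero, incl_zero]
  obtain ⟨F, hF, hDF, hFt, hFθ⟩ := exists_contact_lift hD hE.1 h0
  have ht := hF.smooth.tendsto_zero hF.map_zero
  have hFmem : F ∈ CTTheta m n := mem_CTTheta hF.smooth (hasPForm_of_comp hD hE ht hDF hFt) (by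
    filter_upwards [hFθ, hE.2] with x h1 h2 v
    rw [h1, h2])
  have hD'F := comp_mem_CTTheta hD' hFmem hF.map_zero
  obtain ⟨U, hU, hinj⟩ := hD.1.1.smooth.eventually_injective hD.1.1.immersive
  have hFφ : ∀ᶠ x in 𝓝[corner m n r] 0, F x = incl (φ (dropZ x)) := by
    filter_upwards [hDE, eventually_nhdsWithin_of_eventually_nhds hDF,
      eventually_nhdsWithin_of_eventually_nhds (ht.eventually hU),
      hφ.eventually_corner (eventually_nhdsWithin_of_eventually_nhds hU)] with x h1 h2 h3 h4
    exact hinj h3 h4 (h2.trans h1.symm)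
  have hEj : SameJet l (fun y => E (incl y)) (fun y => D' (F (incl y))) := by
    have hi : SmoothGerm (incl : JetZ m n → Jet m n) :=
      ContDiff.smoothGerm (inclL (m := m) (n := n)).contDiff
    have h1 : SameJet l (fun x => D (F x)) (fun x => D' (F x)) :=
      SameJet.comp hD.1.1.smooth hD'.1.1.smooth hF.smooth hF.smooth hF.map_zero
        (SameJet.of_comp_incl hD hD' hDj) (SameJet.refl _ _)
    exact SameJet.comp (g' := fun x => D' (F x)) hE.1.1.smooth hD'F.1.1.smooth hi hi rfl
      ((SameJet.of_eventuallyEq hDF l).symm.trans h1) (SameJet.refl _ _)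
  have hEL' : Extends r L ((fun y => E (incl y)) ∘ dropZ) :=
    cornerInvariant_extends _ _ _ ((eventually_comp_incl_dropZ E).mono fun x hx => hx.symm) hEL
  have hD'L := (h _ (mem_CTThetaZ hE) hEL' _ (mem_CTThetaZ hD'F) hEj).congr
    (eventually_comp_incl_dropZ fun x => D' (F x))
  -- On 𝕃 the germ F is φ, so D' ∘ F ∘ (ψ ∘ φ') = D' ∘ φ' = C'; this dictates the reparametrization
  -- ψ ∘ φ'.
  refine (PLegendrianEquivalent.of_reparametrization hC' hD'F (hψ.comp hφ') ?_ hD'L).congr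
    ((eventually_comp_dropZ hcC').mono fun x hx => hx.symm)
  have hφψ' := hφ'.eventually_corner (eventually_corner_of_eventually_zero (r := r) hφψ)
  filter_upwards [(hψ.comp hφ').eventually_corner hFφ, hφψ',
    eventually_corner_of_eventually_zero hDC', eventually_corner_zc r] with x h1 h2 h3 h4
  rw [h1, dropZ_incl]
  rw [dropZ_incl] at h2
  rw [h2, h3, incl_dropZ h4]

end Determinacy

end RetLeg

/-- The four implications, first with `C` an extension of `L` when `C|_𝕃 = L`, then with `C` an
extension of `L` when `C` defines the same configuration as `L`. -/
theorem proposition5p2 (m n r : ℕ) (hr : r ≤ n) (L : RetLeg.Jet m n → RetLeg.Jet m n)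
    (hL : RetLeg.IsReticularLegendrianUnfolding r L) (l : ℕ) :
    ((RetLeg.Determined r (RetLeg.Extends r) l L →
        RetLeg.DeterminedTheta r (RetLeg.Extends r) l L) ∧
      (RetLeg.DeterminedTheta r (RetLeg.Extends r) l L →
        RetLeg.DeterminedThetaZ r (RetLeg.Extends r) l L) ∧
      ((∃ C ∈ RetLeg.CTTheta m n, RetLeg.Extends r L C) →
        RetLeg.DeterminedThetaZ r (RetLeg.Extends r) l L →
        RetLeg.DeterminedZ r (RetLeg.Extends r) (l + 1) L) ∧
      (RetLeg.DeterminedZ r (RetLeg.Extends r) l L →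
        RetLeg.Determined r (RetLeg.Extends r) l L)) ∧
    ((RetLeg.Determined r (RetLeg.Defines r) l L →
        RetLeg.DeterminedTheta r (RetLeg.Defines r) l L) ∧
      (RetLeg.DeterminedTheta r (RetLeg.Defines r) l L →
        RetLeg.DeterminedThetaZ r (RetLeg.Defines r) l L) ∧
      (RetLeg.DeterminedThetaZ r (RetLeg.Defines r) l L →
        RetLeg.DeterminedZ r (RetLeg.Defines r) (l + 1) L) ∧
      (RetLeg.DeterminedZ r (RetLeg.Defines r) l L →
        RetLeg.Determined r (RetLeg.Defines r) l L)) := by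
  open RetLeg in
  exact ⟨⟨Determined.determinedTheta,
      DeterminedTheta.determinedThetaZ cornerInvariant_extends,
      DeterminedThetaZ.determinedZ_extends,
      DeterminedZ.determined cornerInvariant_extends⟩,
    Determined.determinedTheta,
    DeterminedTheta.determinedThetaZ cornerInvariant_defines,
    DeterminedThetaZ.determinedZ_defines,
    DeterminedZ.determined cornerInvariant_defines⟩
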